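/- Let $L/K$ be a finite separable field extension of degree $2^e$, with normal closure $\widetilde L/K$ and $G=\mathrm{Gal}(\widetilde L/K)$. A \emph{Hopf--Galois structure} on $L/K$ is a finite-dimensional cocommutative $K$-Hopf algebra $H$ together with an action making $L$ an $H$-module algebra such that the map $L\otimes_K H\to \mathrm{End}_K(L)$, $l\otimes h\mapsto (x\mapsto l\,(h\cdot x))$, is bijective. With $M$ the normal closure of $L/K$, it is of \emph{type} $N$, for a group $N$, if $M\otimes_K H\cong M[N]$ as $M$-Hopf algebras, and of \emph{cyclic type} if it is of type $N$ for some cyclic group $N$; the same definitions apply to every finite separable extension of $K$, with its own normal closure as $M$. An extension $L'/K$ is \emph{parallel} to $L/K$ if $K\subseteq L'\subseteq \widetilde L$ and $[L':K]=[L:K]$. Suppose that $L/K$ admits a Hopf--Galois structure of cyclic type. Then $|G|=2^s[L:K]$ for some integer $s\ge 0$, and the following hold. (1) If $s=1$ and $G$ has an element of order $[L:K]$, then every extension $L'/K$ parallel to $L/K$ admits a Hopf--Galois structure of cyclic type. (2) If $s=1$ and $G$ has no element of order $[L:K]$, or if $s\ge 2$, then there is a normal extension $L'/K$ parallel to $L/K$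 that does not admit a Hopf--Galois structure of cyclic type. -/

import Mathlib

open scoped TensorProduct

universe u v w

/-- A Hopf-Galois structure on a finite field extension `L/K` with underlying `K`-Hopf algebra `H`:
`H` is finite-dimensional and cocommutative, `L` is a (left) `H`-module algebra, and the `K`-linear
map `L ⊗ H → End_K(L)`, `l ⊗ h ↦ (x ↦ l · (h x))`, is bijective. -/
structure HopfGaloisStructure (K : Type u) (L : Type v) (H : Type w) [Field K] [Field L]
    [Algebra K L] [Ring H] [HopfAlgebra K H] where
  finite : Module.Finite K H
  cocomm : Coalgebra.IsCocomm K H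
  /-- The action of `H` on `L`, making `L` a left `H`-module. -/
  action : H →ₐ[K] Module.End K L
  /-- `h 1 = ε(h) 1`. -/
  action_one : ∀ h : H, action h 1 = algebraMap K L (Coalgebra.counit (R := K) h)
  /-- `h (x y) = ∑ (h₁ x) (h₂ y)`, where `Δ(h) = ∑ h₁ ⊗ h₂`. -/
  action_mul : ∀ (h : H) (x y : L),
    action h (x * y) =
      LinearMap.mul' K L
        (TensorProduct.homTensorHomMap (RingHom.id K) L L L L
          (TensorProduct.map action.toLinearMap action.toLinearMap
            (Coalgebra.comul (R := K) h)) (x ⊗ₜ[K] y))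
  galois : Function.Bijective
    (LinearMap.mul' K (Module.End K L) ∘ₗ
      TensorProduct.map (Algebra.lmul K L).toLinearMap action.toLinearMap)

/-- The normal closure of `L/K` (inside an algebraic closure of `L`). -/
abbrev NormalClosureOver (K : Type u) (L : Type v) [Field K] [Field L] [Algebra K L] : Type v :=
  IntermediateField.normalClosure K L (AlgebraicClosure L)

/-- `NormalClosureOver K L` is a normal closure of `L/K`, hence isomorphic over `K` to any other. -/
theorem isNormalClosure_normalClosureOver (K : Type u) (L : Type v) [Field K] [Field L]
    [Algebra K L] [Algebra.IsAlgebraic K L] : IsNormalClosure K L (NormalClosureOver K L) :=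
  Algebra.IsAlgebraic.isNormalClosure_normalClosure fun _ => IsAlgClosed.splits _

/-- `H` is of type `N` for the extension `L/K`: over the normal closure `M` of `L/K`, the Hopf
algebra `M ⊗ H` becomes isomorphic to the group algebra `M[N]`, i.e. `H` is the descent of `M[N]`
along `M/K`. (An isomorphism of bialgebras between Hopf algebras preserves the antipode.) -/
def HopfAlgebraIsOfType (K : Type u) (L : Type v) (H : Type w) [Field K] [Field L]
    [Algebra K L] [Ring H] [HopfAlgebra K H] (N : Type*) [Group N] : Prop :=
  Nonempty ((NormalClosureOver K L ⊗[K] H) ≃ₐc[NormalClosureOver K L]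
    MonoidAlgebra (NormalClosureOver K L) N)

/-- `L/K` admits a Hopf-Galois structure of type `N`. (A finite-dimensional `K`-Hopf algebra always
has an isomorphic copy in the universe of `K`.) -/
def AdmitsHopfGaloisStructureOfType (K : Type u) (L : Type v) [Field K] [Field L] [Algebra K L]
    (N : Type*) [Group N] : Prop :=
  ∃ (H : Type u) (_ : Ring H) (_ : HopfAlgebra K H),
    Nonempty (HopfGaloisStructure K L H) ∧ HopfAlgebraIsOfType K L H N

/-- `L/K` admits a Hopf-Galois structure of cyclic type. -/
def AdmitsCyclicHopfGaloisStructure (K : Type u) (L : Type v) [Field K] [Field L]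
    [Algebra K L] : Prop :=
  ∃ (N : Type) (_ : Group N), IsCyclic N ∧ AdmitsHopfGaloisStructureOfType K L N

/-- For `E` a normal closure of `L/K`, an intermediate field `L'` of `E/K` is parallel to `L/K` if
`[L' : K] = [L : K]`. -/
def IsParallelTo {K : Type u} {E : Type w} [Field K] [Field E] [Algebra K E]
    (L' : IntermediateField K E) (L : Type v) [Field L] [Algebra K L] [IsNormalClosure K L E] :
    Prop :=
  Module.finrank K L' = Module.finrank K L

/-! Cyclic Hopf-Galois structures become affine group actions. In a structure of cyclic type the
elements of `N`, seen as group-like elements of `M ⊗ H`, permute the embeddings of `L` simply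
transitively, and the Galois group normalises this action. Hence the embeddings can be labelled by
`ZMod n` so that Galois acts by maps `y ↦ a * y + b` (`HopfGaloisStructure.exists_equiv_zmod`).
Conversely, given such a labelling, the Galois invariants of `M[N]` form a Hopf algebra acting on
`L` through translation of labels (`IsAffineLabelling.admitsCyclicHopfGaloisStructure`).

Thus `G` is a faithful transitive group of affine maps of `ZMod (2 ^ e)`, and a parallel `L'` with
group `J` has a cyclic structure as soon as `G` has some transitive affine action with stabilizer
`J`. The remaining work concerns the iterates `g ^ m : 0 ↦ (1 + a + ... + a ^ (m - 1)) * b`; for `m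
= 2 ^ k` and odd `a`, the 2-adic valuation of the geometric sum is exactly `k` if `a ≡ 1 mod 4`, and
is larger if `a ≡ 3 mod 4` and `k ≥ 1`.

For (1), `J` has order two and `G` has a cyclic subgroup `⟨g⟩` of index two; an explicit action with
stabilizer `J` is written down according to whether `J` lies in `⟨g⟩`
(`AffineAction.exists_stabilizer_eq`). For (2), `J` is the normal subgroup of translations killed by
`2 ^ s`. It contains every `2 ^ (e - 2)`-th power (`pow_mem_torsionTranslations`), whereas a
transitive affine group of degree `2 ^ e` has an element whose `2 ^ (e - 2)`-th power moves `0`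
(`exists_b_pow_ne_zero`). -/

set_option linter.unusedSectionVars false

/-! ### Geometric sums of `2`-power length -/

/-- Each doubling of the length contributes a factor `1 + x ^ 2 ^ k`; its residue mod 4 drives the
estimates below. -/
theorem geom_sum_two_pow_succ (x : ℤ) (k : ℕ) :
    ∑ i ∈ Finset.range (2 ^ (k + 1)), x ^ i =
      (∑ i ∈ Finset.range (2 ^ k), x ^ i) * (1 + x ^ 2 ^ k) := by
  rw [pow_succ, mul_two, Finset.sum_range_add, mul_add, mul_one, Finset.sum_mul]
  simp only [pow_add, mul_comm]

theorem four_mul_two_pow_dvd_pow_sub_one {x : ℤ} (hx : Odd x) {k : ℕ} (hk : 1 ≤ k) :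
    (2 : ℤ) ^ (k + 2) ∣ x ^ 2 ^ k - 1 := by
  induction k, hk using Nat.le_induction with
  | base => exact Int.eight_dvd_sq_sub_one_of_odd hx
  | succ k _ ih =>
    have h2 : (2 : ℤ) ∣ x ^ 2 ^ k + 1 := (hx.pow.add_odd odd_one).two_dvd
    have : x ^ 2 ^ (k + 1) - 1 = (x ^ 2 ^ k - 1) * (x ^ 2 ^ k + 1) := by ring
    rw [this, show k + 1 + 2 = (k + 2) + 1 by ring, pow_succ]
    exact mul_dvd_mul ih h2

theorem two_pow_dvd_geom_sum {x : ℤ} (hx : Odd x) (k : ℕ) :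
    (2 : ℤ) ^ k ∣ ∑ i ∈ Finset.range (2 ^ k), x ^ i := by
  induction k with
  | zero => simp
  | succ k ih =>
    rw [geom_sum_two_pow_succ, pow_succ]
    exact mul_dvd_mul ih (odd_one.add_odd hx.pow).two_dvd

/-- The gain over `two_pow_dvd_geom_sum` comes from the first factor `1 + x`, which is divisible by
4. -/
theorem two_pow_succ_dvd_geom_sum {x : ℤ} (hx : x % 4 = 3) {k : ℕ} (hk : 1 ≤ k) :
    (2 : ℤ) ^ (k + 1) ∣ ∑ i ∈ Finset.range (2 ^ k), x ^ i := by
  have hodd : Odd x := Int.odd_iff.2 (by lia)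
  induction k, hk using Nat.le_induction with
  | base => simp [Finset.sum_range_succ]; lia
  | succ k _ ih =>
    rw [geom_sum_two_pow_succ, pow_succ]
    exact mul_dvd_mul ih (odd_one.add_odd hodd.pow).two_dvd

/-- Here every factor `1 + x ^ 2 ^ k` is `2` mod 4, so each doubling adds exactly one factor 2. -/
theorem geom_sum_two_pow_eq {x : ℤ} (hx : x % 4 = 1) (k : ℕ) :
    ∃ c, Odd c ∧ ∑ i ∈ Finset.range (2 ^ k), x ^ i = 2 ^ k * c := by
  induction k with
  | zero => exact ⟨1, odd_one, by simp⟩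
  | succ k ih =>
    obtain ⟨c, hc, h⟩ := ih
    obtain ⟨d, hd⟩ : ∃ d, x ^ 2 ^ k = 4 * d + 1 := by
      have : x ^ 2 ^ k ≡ 1 ^ 2 ^ k [ZMOD 4] := Int.ModEq.pow _ hx
      rw [one_pow] at this
      exact ⟨(x ^ 2 ^ k) / 4, by have := this.eq; lia⟩
    refine ⟨c * (2 * d + 1), hc.mul ⟨d, rfl⟩, ?_⟩
    rw [geom_sum_two_pow_succ, h, hd]
    ring

theorem not_two_pow_dvd {c : ℤ} (hc : Odd c) {i e : ℕ} (h : i < e) : ¬ (2 : ℤ) ^ e ∣ 2 ^ i * c := by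
  intro hd
  have h1 : (2 : ℤ) ^ i * 2 ∣ 2 ^ i * c :=
    (pow_succ (2 : ℤ) i ▸ pow_dvd_pow 2 h).trans hd
  have := (mul_dvd_mul_iff_left (pow_ne_zero i two_ne_zero)).1 h1
  exact (Int.not_even_iff_odd.2 hc) (even_iff_two_dvd.2 this)

/-! ### Affine actions on `ZMod n` -/

/-- An action of `G` on `ZMod n` by affine maps `y ↦ a g * y + b g`. -/
structure AffineAction (G : Type*) [Group G] (n : ℕ) where
  a : G →* ZMod n
  b : G → ZMod n
  b_mul : ∀ g h, b (g * h) = a g * b h + b g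

namespace AffineAction

variable {G : Type*} [Group G] {n : ℕ} (A : AffineAction G n)

/-- The affine action is faithful. -/
def Faithful : Prop := ∀ g, A.a g = 1 → A.b g = 0 → g = 1

/-- The affine action is transitive. -/
def Transitive : Prop := Function.Surjective A.b

theorem b_one : A.b 1 = 0 := by simpa using A.b_mul 1 1

theorem b_pow (g : G) (m : ℕ) : A.b (g ^ m) = (∑ i ∈ Finset.range m, A.a g ^ i) * A.b g := by
  induction m with
  | zero => simp [A.b_one]
  | succ m ih => rw [pow_succ', A.b_mul, ih, geom_sum_succ]; ring

/-- An affine action from a family of affine permutations. -/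
def ofPerm (φ : G →* Equiv.Perm (ZMod n)) (h : ∀ g, ∃ a b, ∀ y, φ g y = a * y + b) :
    AffineAction G n :=
  -- The coefficients are read off from the images of `0` and `1`, so they are canonical and
  -- multiplicativity can be checked without choices.
  have key : ∀ g y, φ g y = (φ g 1 - φ g 0) * y + φ g 0 := fun g y => by
    obtain ⟨a, b, h⟩ := h g
    simp only [h]; ring
  { a :=
      { toFun := fun g => φ g 1 - φ g 0
        map_one' := by simp
        map_mul' := fun g g' => by
          simp only [map_mul, Equiv.Perm.mul_apply]
          rw [key g (φ g' 1), key g (φ g' 0)]; ring }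
    b := fun g => φ g 0
    b_mul := fun g g' => by
      rw [map_mul, Equiv.Perm.mul_apply]
      exact key g _ }

theorem ofPerm_b (φ : G →* Equiv.Perm (ZMod n)) (h) (g : G) : (ofPerm φ h).b g = φ g 0 := rfl

/-- The stabilizer of `0`. -/
def stabilizer : Subgroup G where
  carrier := {g | A.b g = 0}
  mul_mem' {g h} hg hh := by
    simp only [Set.mem_ofPred_eq] at *
    rw [A.b_mul, hg, hh]; simp
  one_mem' := A.b_one
  inv_mem' {g} hg := by
    have := A.b_mul g⁻¹ g
    simp only [Set.mem_ofPred_eq] at *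
    simpa [A.b_one, hg] using this.symm

@[simp] theorem mem_stabilizer {g : G} : g ∈ A.stabilizer ↔ A.b g = 0 := Iff.rfl

theorem isUnit_a (g : G) : IsUnit (A.a g) := (Group.isUnit g).map A.a

theorem b_eq_iff (g h : G) : A.b g = A.b h ↔ g⁻¹ * h ∈ A.stabilizer := by
  have h1 : A.b h = A.a g * A.b (g⁻¹ * h) + A.b g := by rw [← A.b_mul]; simp
  rw [mem_stabilizer, h1, right_eq_add, (A.isUnit_a g).mul_right_eq_zero]

/-- Cosets of the stabilizer inject into `ZMod n`. -/
def orbitMap : G ⧸ A.stabilizer → ZMod n :=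
  Quotient.lift A.b fun g h hgh => (A.b_eq_iff g h).2 (QuotientGroup.leftRel_apply.1 hgh)

theorem orbitMap_injective : Function.Injective A.orbitMap := by
  rintro ⟨g⟩ ⟨h⟩ hgh
  exact QuotientGroup.eq.2 ((A.b_eq_iff g h).1 hgh)

theorem index_stabilizer (hA : A.Transitive) : A.stabilizer.index = n := by
  rw [Subgroup.index]
  refine Eq.trans (Nat.card_eq_of_bijective A.orbitMap ⟨A.orbitMap_injective, fun y => ?_⟩) (Nat.card_zmod n)
  obtain ⟨g, hg⟩ := hA y
  exact ⟨(g : G ⧸ A.stabilizer), hg⟩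

theorem transitive_of_index [NeZero n] (h : A.stabilizer.index = n) : A.Transitive := by
  have : Function.Bijective A.orbitMap := by
    have : Finite (G ⧸ A.stabilizer) := Finite.of_injective _ A.orbitMap_injective
    refine Function.Injective.bijective_of_nat_card_le A.orbitMap_injective ?_
    rw [Nat.card_zmod]; exact h.ge
  intro y
  obtain ⟨⟨g⟩, hg⟩ := this.2 y
  exact ⟨g, hg⟩

/-- Translations: `b` restricted to the kernel of `a`. -/
def kerHom : A.a.toHomUnits.ker →* Multiplicative (ZMod n) where
  toFun g := Multiplicative.ofAdd (A.b g)
  map_one' := by simp [A.b_one]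
  map_mul' g h := by
    have : A.a g = 1 := by simpa using congrArg Units.val g.2
    rw [← ofAdd_add, Subgroup.coe_mul, A.b_mul, this, one_mul, add_comm]

theorem mem_ker {g : G} : g ∈ A.a.toHomUnits.ker ↔ A.a g = 1 := by
  rw [MonoidHom.mem_ker, Units.ext_iff]; rfl

theorem kerHom_injective (hA : A.Faithful) : Function.Injective A.kerHom := by
  rw [injective_iff_map_eq_one]
  rintro ⟨g, hg⟩ h
  exact Subtype.ext (hA g (A.mem_ker.1 hg) h)

/-! ### Affine groups of 2-power degree -/

section TwoPow

variable {e : ℕ} (A : AffineAction G (2 ^ e))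

/-- Integer representatives give access to residues mod 4 and to divisibility by powers of 2. -/
theorem exists_int (he : 1 ≤ e) (g : G) : ∃ x y : ℤ, Odd x ∧ (x : ZMod (2 ^ e)) = A.a g ∧
    (y : ZMod (2 ^ e)) = A.b g := by
  refine ⟨(A.a g).cast, (A.b g).cast, ?_, ZMod.intCast_zmod_cast _, ZMod.intCast_zmod_cast _⟩
  have h := A.isUnit_a g
  by_contra hne
  rw [Int.not_odd_iff_even, even_iff_two_dvd] at hne
  obtain ⟨c, hc⟩ := hne
  have h2 : IsUnit ((ZMod.castHom (dvd_pow_self 2 (by lia)) (ZMod 2)) (A.a g)) := h.map _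
  rw [← ZMod.intCast_zmod_cast (A.a g), hc, map_intCast, Int.cast_mul,
    show ((2 : ℤ) : ZMod 2) = 0 from rfl, zero_mul] at h2
  exact not_isUnit_zero h2

theorem b_pow_two_pow {g : G} {x y : ℤ} (hx : (x : ZMod (2 ^ e)) = A.a g)
    (hy : (y : ZMod (2 ^ e)) = A.b g) (k : ℕ) :
    A.b (g ^ 2 ^ k) = (((∑ i ∈ Finset.range (2 ^ k), x ^ i) * y : ℤ) : ZMod (2 ^ e)) := by
  rw [A.b_pow, ← hx, ← hy]; push_cast; rfl

theorem intCast_eq_zero_iff (z : ℤ) : (z : ZMod (2 ^ e)) = 0 ↔ (2 : ℤ) ^ e ∣ z := by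
  rw [ZMod.intCast_zmod_eq_zero_iff_dvd]; push_cast; rfl

theorem a_pow_eq_one {g : G} {k : ℕ} (hk : 1 ≤ k) (hke : e ≤ k + 2) : A.a (g ^ 2 ^ k) = 1 := by
  rcases Nat.eq_zero_or_pos e with rfl | he
  · exact Subsingleton.elim (α := ZMod 1) _ _
  obtain ⟨x, y, hx, hxa, -⟩ := A.exists_int he g
  rw [map_pow, ← hxa, ← sub_eq_zero]
  have := (intCast_eq_zero_iff (e := e) (x ^ 2 ^ k - 1)).2
    ((pow_dvd_pow 2 hke).trans (four_mul_two_pow_dvd_pow_sub_one hx hk))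
  exact_mod_cast this

/-- A transitive group of affine maps of `ZMod (2 ^ e)` has an element of order at least
`2 ^ (e - 1)`. -/
theorem exists_b_pow_ne_zero (hA : A.Transitive) (he : 2 ≤ e) :
    ∃ g, A.b (g ^ 2 ^ (e - 2)) ≠ 0 := by
  -- If `a ≡ 1 mod 4` and `b` is odd, then `g ^ 2 ^ (e - 2)` sends `0` to `2 ^ (e - 2)` times an odd
  -- number.
  by_cases hc : ∃ g : G, ∃ x y : ℤ, x % 4 = 1 ∧ Odd y ∧ (x : ZMod (2 ^ e)) = A.a g ∧
      (y : ZMod (2 ^ e)) = A.b g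
  · obtain ⟨g, x, y, hx, hy, hxa, hyb⟩ := hc
    refine ⟨g, ?_⟩
    obtain ⟨c, hc, hs⟩ := geom_sum_two_pow_eq hx (e - 2)
    rw [A.b_pow_two_pow hxa hyb, Ne, intCast_eq_zero_iff, hs, mul_assoc]
    exact not_two_pow_dvd (hc.mul hy) (by lia)
  -- Otherwise odd `b` forces `a ≡ 3 mod 4`. Take `t : 0 ↦ 1` and `g : 0 ↦ 2`. If also `a g ≡ 3`,
  -- then `t * g` would have `a ≡ 1` and `b` odd. So `a g ≡ 1`, and `0` is moved by `2 ^ (e - 1)`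
  -- times an odd number.
  · push Not at hc
    obtain ⟨t, ht⟩ := hA 1
    obtain ⟨g, hg⟩ := hA 2
    obtain ⟨z, -, hz, hza, -⟩ := A.exists_int (by lia) t
    obtain ⟨x, -, hx, hxa, -⟩ := A.exists_int (by lia) g
    have hz3 : z % 4 = 3 := by
      have := hc t z 1
      by_contra h
      exact this (by obtain ⟨d, rfl⟩ := hz; lia) odd_one hza (by simp [ht])
    have hx1 : x % 4 = 1 := by
      by_contra h
      have hx3 : x % 4 = 3 := by obtain ⟨d, rfl⟩ := hx; lia
      refine hc (t * g) (z * x) (z * 2 + 1) ?_ ⟨z, by ring⟩ ?_ ?_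
      · rw [Int.mul_emod, hz3, hx3]; rfl
      · rw [map_mul, ← hza, ← hxa]; push_cast; rfl
      · rw [A.b_mul, ← hza, hg, ht]; push_cast; rfl
    refine ⟨g, ?_⟩
    obtain ⟨c, hc, hs⟩ := geom_sum_two_pow_eq hx1 (e - 2)
    rw [A.b_pow_two_pow hxa (y := 2) (by simp [hg]), Ne, intCast_eq_zero_iff, hs,
      show (2 : ℤ) ^ (e - 2) * c * 2 = 2 ^ (e - 2 + 1) * c by ring]
    exact not_two_pow_dvd hc (by lia)

/-- The image of `0` under `g ^ 2 ^ k` has valuation exactly `k`, so `0` first returns at exponent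
`2 ^ e`; there the linear part is trivial too and faithfulness applies. -/
theorem orderOf_eq (hA : A.Faithful) (he : 2 ≤ e) {g : G} {x y : ℤ} (hx : x % 4 = 1) (hy : Odd y)
    (hxa : (x : ZMod (2 ^ e)) = A.a g) (hyb : (y : ZMod (2 ^ e)) = A.b g) :
    orderOf g = 2 ^ e := by
  obtain ⟨f, rfl⟩ : ∃ f, e = f + 1 := ⟨e - 1, by lia⟩
  refine orderOf_eq_prime_pow (fun h => ?_) (hA _ (A.a_pow_eq_one (by lia) (by lia)) ?_)
  · have h1 := A.b_pow_two_pow hxa hyb f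
    rw [h, A.b_one, eq_comm, intCast_eq_zero_iff] at h1
    obtain ⟨c, hc, hs⟩ := geom_sum_two_pow_eq hx f
    rw [hs, mul_assoc] at h1
    exact not_two_pow_dvd (hc.mul hy) (by lia) h1
  · rw [A.b_pow_two_pow hxa hyb, intCast_eq_zero_iff]
    exact (two_pow_dvd_geom_sum (Int.odd_iff.2 (by lia)) _).mul_right _

theorem card_ker_mul_card_range : Nat.card A.a.toHomUnits.ker * Nat.card A.a.toHomUnits.range =
    Nat.card G := by
  rw [← Subgroup.index_ker, Subgroup.card_mul_index]

theorem card_range_dvd (he : 1 ≤ e) : Nat.card A.a.toHomUnits.range ∣ 2 ^ (e - 1) := by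
  have := Subgroup.card_subgroup_dvd_card A.a.toHomUnits.range
  rwa [Nat.card_eq_fintype_card (α := (ZMod (2 ^ e))ˣ), ZMod.card_units_eq_totient,
    Nat.totient_prime_pow Nat.prime_two (by lia), show 2 - 1 = 1 from rfl, mul_one] at this

theorem card_ker_dvd (hA : A.Faithful) : Nat.card A.a.toHomUnits.ker ∣ 2 ^ e := by
  have := Subgroup.card_dvd_of_injective _ (A.kerHom_injective hA)
  rwa [Nat.card_congr Multiplicative.toAdd, Nat.card_zmod] at this

/-- Kernel and image of `a` are 2-groups, and transitivity makes the degree divide the order. -/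
theorem exists_card_eq (hA : A.Faithful) (hT : A.Transitive) :
    ∃ s, Nat.card G = 2 ^ s * 2 ^ e := by
  have h1 : ∃ t, Nat.card G = 2 ^ t := by
    rw [← A.card_ker_mul_card_range]
    obtain ⟨i, -, hi⟩ := (Nat.dvd_prime_pow Nat.prime_two).1 (A.card_ker_dvd hA)
    rcases Nat.eq_zero_or_pos e with rfl | he
    · refine ⟨i, ?_⟩
      have : Subsingleton (ZMod (2 ^ 0))ˣ := ⟨fun _ _ => Units.ext (Subsingleton.elim (α := ZMod 1) _ _)⟩
      have : Nat.card A.a.toHomUnits.range = 1 := Nat.card_unique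
      rw [this, hi, mul_one]
    · obtain ⟨j, -, hj⟩ := (Nat.dvd_prime_pow Nat.prime_two).1 (A.card_range_dvd he)
      exact ⟨i + j, by rw [hi, hj, pow_add]⟩
  obtain ⟨t, ht⟩ := h1
  have h2 : 2 ^ e ∣ 2 ^ t := by
    rw [← ht, ← A.index_stabilizer hT]; exact Subgroup.index_dvd_card _
  have h3 : e ≤ t := (Nat.pow_dvd_pow_iff_le_right (by lia)).1 h2
  exact ⟨t - e, by rw [ht, ← pow_add]; congr 1; lia⟩

/-- The unit group has order only `2 ^ (e - 1)`, so at least `2 ^ (s + 1)` of the order of `G` must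
come from translations, of which there are at most `2 ^ e`. -/
theorem two_pow_succ_dvd_card_ker (hA : A.Faithful) (he : 1 ≤ e) {s : ℕ}
    (hG : Nat.card G = 2 ^ s * 2 ^ e) : 2 ^ (s + 1) ∣ Nat.card A.a.toHomUnits.ker ∧ s + 1 ≤ e := by
  obtain ⟨i, hie, hi⟩ := (Nat.dvd_prime_pow Nat.prime_two).1 (A.card_ker_dvd hA)
  obtain ⟨j, hje, hj⟩ := (Nat.dvd_prime_pow Nat.prime_two).1 (A.card_range_dvd he)
  have h := A.card_ker_mul_card_range
  rw [hi, hj, hG, ← pow_add, ← pow_add] at h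
  have := Nat.pow_right_injective le_rfl h
  exact ⟨hi ▸ pow_dvd_pow 2 (by lia), by lia⟩

/-- The translations in `G` killed by `2 ^ s`. -/
def torsionTranslations (s : ℕ) : Subgroup G where
  carrier := {g | A.a g = 1 ∧ 2 ^ s * A.b g = 0}
  mul_mem' := by
    rintro g h ⟨hg, hg'⟩ ⟨hh, hh'⟩
    exact ⟨by simp [hg, hh], by rw [A.b_mul, hg, one_mul, mul_add, hg', hh', add_zero]⟩
  one_mem' := ⟨map_one _, by simp [A.b_one]⟩
  inv_mem' := by
    rintro g ⟨hg, hg'⟩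
    have h1 : A.a g⁻¹ = 1 := by
      have : A.a g⁻¹ * A.a g = 1 := by rw [← map_mul]; simp
      simpa [hg] using this
    have h2 := A.b_mul g⁻¹ g
    rw [inv_mul_cancel, A.b_one, h1, one_mul] at h2
    exact ⟨h1, by rw [eq_neg_of_add_eq_zero_right h2.symm, mul_neg, hg', neg_zero]⟩

instance torsionTranslations_normal (s : ℕ) : (A.torsionTranslations s).Normal where
  conj_mem := by
    rintro g ⟨hg, hg'⟩ h
    have h1 : A.a h * A.a h⁻¹ = 1 := by rw [← map_mul]; simp
    refine ⟨by rw [map_mul, map_mul, hg, mul_one, h1], ?_⟩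
    have h2 := A.b_mul h h⁻¹
    rw [mul_inv_cancel, A.b_one] at h2
    rw [A.b_mul, A.b_mul, map_mul, hg, mul_one]
    linear_combination A.a h * hg' - 2 ^ s * h2

/-- The translations in `G` form a cyclic group, in which `z ^ 2 ^ s = 1` has at most `2 ^ s`
solutions; a subgroup of order `2 ^ s` supplies that many. -/
theorem card_torsionTranslations [Finite G] (hA : A.Faithful) (he : 1 ≤ e) {s : ℕ}
    (hG : Nat.card G = 2 ^ s * 2 ^ e) : Nat.card (A.torsionTranslations s) = 2 ^ s := by
  classical
  have : IsCyclic A.a.toHomUnits.ker := isCyclic_of_injective _ (A.kerHom_injective hA)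
  have : Fintype A.a.toHomUnits.ker := Fintype.ofFinite _
  refine le_antisymm ?_ ?_
  · refine le_trans ?_ (IsCyclic.card_pow_eq_one_le (α := A.a.toHomUnits.ker) (n := 2 ^ s)
      (by positivity))
    rw [← Fintype.card_coe, ← Nat.card_eq_fintype_card]
    refine Nat.card_le_card_of_injective (fun g => ⟨⟨g, A.mem_ker.2 g.2.1⟩, ?_⟩) fun g h hgh => ?_
    · simp only [Finset.mem_filter, Finset.mem_univ, true_and]
      refine Subtype.ext (hA _ ?_ ?_)
      · simp [g.2.1]
      · simpa [A.b_pow, g.2.1] using g.2.2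
    · exact Subtype.ext (congrArg (fun z => (z.1 : G)) hgh)
  · obtain ⟨J, hJ⟩ := Sylow.exists_subgroup_card_pow_prime (G := A.a.toHomUnits.ker) 2 (n := s)
      ((pow_dvd_pow 2 (Nat.le_succ s)).trans (A.two_pow_succ_dvd_card_ker hA he hG).1)
    rw [← hJ]
    refine Nat.card_le_card_of_injective (fun g => ⟨g.1.1, A.mem_ker.1 g.1.2, ?_⟩)
      fun g h hgh => ?_
    · have h1 : (g.1.1 : G) ^ 2 ^ s = 1 := by
        have := congrArg (fun z : J => (z.1.1 : G)) (pow_card_eq_one' (x := g))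
        rwa [hJ] at this
      have h2 := A.b_pow g.1.1 (2 ^ s)
      rw [h1, A.b_one, A.mem_ker.1 g.1.2] at h2
      simpa using h2.symm
    · exact Subtype.ext (Subtype.ext (congrArg (fun z => z.1) hgh))

/-- If `s ≥ 2`, or `s = 1` and `G` has no element of order `2 ^ e`, then the quotient of `G` by
`torsionTranslations s` has exponent dividing `2 ^ (e - 2)`. -/
theorem pow_mem_torsionTranslations [Finite G] (hA : A.Faithful) {s : ℕ} (he : 2 ≤ e)
    (hs : s = 1 ∧ (¬ ∃ g : G, orderOf g = 2 ^ e) ∨ 2 ≤ s) (hG : Nat.card G = 2 ^ s * 2 ^ e)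
    (g : G) : g ^ 2 ^ (e - 2) ∈ A.torsionTranslations s := by
  obtain ⟨hker, hse⟩ := A.two_pow_succ_dvd_card_ker hA (by lia) hG
  -- For `e = 2` and `s = 1`, all four translations lie in `G`, and translation by `1` has the
  -- forbidden order `4`. For `s ≥ 2` the bound is `s + 1 ≤ e`.
  have he3 : 3 ≤ e := by
    by_contra h
    obtain ⟨rfl, hno⟩ : s = 1 ∧ (¬ ∃ g : G, orderOf g = 2 ^ e) := hs.resolve_right (by lia)
    obtain rfl : e = 2 := by lia
    have hb : Function.Bijective A.kerHom :=
      (A.kerHom_injective hA).bijective_of_nat_card_le (by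
        rw [Nat.card_congr Multiplicative.toAdd, Nat.card_zmod]
        exact Nat.le_of_dvd Nat.card_pos hker)
    obtain ⟨⟨g, hg⟩, h1⟩ := hb.2 (Multiplicative.ofAdd 1)
    exact hno ⟨g, A.orderOf_eq hA le_rfl (x := 1) (y := 1) rfl odd_one
      (by simp [A.mem_ker.1 hg]) (by simpa using (Multiplicative.ofAdd.injective h1).symm)⟩
  refine ⟨A.a_pow_eq_one (by lia) (by lia), ?_⟩
  obtain ⟨x, y, hx, hxa, hyb⟩ := A.exists_int (by lia) g
  rw [A.b_pow_two_pow hxa hyb, show (2 : ZMod (2 ^ e)) = ((2 : ℤ) : ZMod (2 ^ e)) by simp,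
    ← Int.cast_pow, ← Int.cast_mul, intCast_eq_zero_iff]
  -- For `s = 1` one factor 2 beyond the general bound `2 ^ (e - 2)` is needed. If `a ≡ 1 mod 4` it
  -- comes from `b`, which is even because odd `b` would give order `2 ^ e`; if `a ≡ 3 mod 4` it
  -- comes from the geometric sum. For `s ≥ 2` the general bound suffices.
  obtain ⟨rfl, hno⟩ | hs := hs
  · rcases (show x % 4 = 1 ∨ x % 4 = 3 by obtain ⟨d, rfl⟩ := hx; lia) with hx1 | hx3
    · have hy : 2 ∣ y := by
        by_contra hy
        exact hno ⟨g, A.orderOf_eq hA he hx1 (Int.not_even_iff_odd.1 fun h => hy h.two_dvd) hxa hyb⟩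
      rw [show (2 : ℤ) ^ e = 2 ^ 1 * 2 ^ ((e - 2) + 1) by rw [← pow_add]; congr 1; lia]
      refine mul_dvd_mul (by simp) ?_
      rw [pow_succ]
      exact mul_dvd_mul (by simpa using two_pow_dvd_geom_sum hx (e - 2)) hy
    · have := two_pow_succ_dvd_geom_sum hx3 (k := e - 2) (by lia)
      rw [show (2 : ℤ) ^ e = 2 ^ 1 * 2 ^ ((e - 2) + 1) by rw [← pow_add]; congr 1; lia]
      exact mul_dvd_mul (by simp) (Dvd.dvd.mul_right (by simpa using this) _)
  · refine (pow_dvd_pow (2 : ℤ) (show e ≤ s + (e - 2) by lia)).trans ?_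
    rw [pow_add]
    exact mul_dvd_mul_left _ ((two_pow_dvd_geom_sum hx _).mul_right _)

end TwoPow
end AffineAction

/-! ### Groups with a cyclic subgroup of index two -/

theorem pow_mul_pow_of_mul_eq {M : Type*} [Monoid M] {t u : M} {k : ℕ} (h : t * u = u ^ k * t)
    (i j : ℕ) : t ^ j * u ^ i = u ^ (k ^ j * i) * t ^ j := by
  have h1 : ∀ i, t * u ^ i = u ^ (k * i) * t := fun i => by
    rw [pow_mul]; exact (SemiconjBy.pow_right h i).eq
  induction j generalizing i with
  | zero => simp
  | succ j ih => rw [pow_succ, mul_assoc, h1, ← mul_assoc, ih, mul_assoc, pow_succ, mul_assoc]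

theorem pow_mul_pow_mul_of_mul_eq {M : Type*} [Monoid M] {t u : M} {k : ℕ} (h : t * u = u ^ k * t)
    (i j i' j' : ℕ) : (u ^ i * t ^ j) * (u ^ i' * t ^ j') = u ^ (i + k ^ j * i') * t ^ (j + j') := by
  rw [pow_add, pow_add, mul_assoc, ← mul_assoc (t ^ j), pow_mul_pow_of_mul_eq h]
  simp only [mul_assoc]

/-- A homomorphism out of a group generated by `g` and an involution `τ ∉ ⟨g⟩` normalizing `⟨g⟩`. -/
theorem exists_monoidHom_of_relations {G P : Type*} [Group G] [Group P] {g τ : G} {k : ℕ}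
    (hτ : τ ∉ Subgroup.zpowers g) (hτ2 : τ ^ 2 = 1) (hrel : τ * g = g ^ k * τ)
    (hrep : ∀ x : G, ∃ i j : ℕ, x = g ^ i * τ ^ j) {u t : P} (hu : u ^ orderOf g = 1)
    (ht : t ^ 2 = 1) (htu : t * u = u ^ k * t) :
    ∃ φ : G →* P, ∀ i j : ℕ, φ (g ^ i * τ ^ j) = u ^ i * t ^ j := by
  have hwd : ∀ i j i' j' : ℕ, g ^ i * τ ^ j = g ^ i' * τ ^ j' → u ^ i * t ^ j = u ^ i' * t ^ j' := by
    intro i j i' j' h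
    -- Only the parity of `j` matters, and it is determined by the element because `τ ∉ ⟨g⟩`.
    have hj : τ ^ j = τ ^ j' ∧ t ^ j = t ^ j' := by
      rw [pow_eq_pow_mod j hτ2, pow_eq_pow_mod j' hτ2, pow_eq_pow_mod j ht, pow_eq_pow_mod j' ht]
      rw [pow_eq_pow_mod j hτ2, pow_eq_pow_mod j' hτ2] at h
      have hg : ∀ m : ℕ, g ^ m ∈ Subgroup.zpowers g := fun m =>
        Subgroup.pow_mem _ (Subgroup.mem_zpowers g) m
      rcases Nat.mod_two_eq_zero_or_one j with h0 | h0 <;>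
        rcases Nat.mod_two_eq_zero_or_one j' with h1 | h1 <;>
        simp only [h0, h1, pow_zero, pow_one, mul_one, and_self] at h ⊢
      · refine absurd ?_ hτ
        rw [← inv_mul_eq_iff_eq_mul] at h
        exact h ▸ Subgroup.mul_mem _ (Subgroup.inv_mem _ (hg _)) (hg _)
      · refine absurd ?_ hτ
        rw [← eq_inv_mul_iff_mul_eq] at h
        exact h ▸ Subgroup.mul_mem _ (Subgroup.inv_mem _ (hg _)) (hg _)
    rw [hj.1] at h
    rw [hj.2, pow_eq_pow_iff_modEq.2 ((pow_eq_pow_iff_modEq.1 (mul_right_cancel h)).of_dvd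
      (orderOf_dvd_of_pow_eq_one hu))]
  choose i j hij using hrep
  have hφ : ∀ m l : ℕ, u ^ i (g ^ m * τ ^ l) * t ^ j (g ^ m * τ ^ l) = u ^ m * t ^ l :=
    fun m l => hwd _ _ _ _ (hij _).symm
  refine ⟨⟨⟨fun x => u ^ i x * t ^ j x, ?_⟩, fun x y => ?_⟩, hφ⟩
  · simpa using hφ 0 0
  · have h2 : x * y = g ^ (i x + k ^ j x * i y) * τ ^ (j x + j y) := by
      rw [← pow_mul_pow_mul_of_mul_eq hrel, ← hij x, ← hij y]
    change u ^ i (x * y) * t ^ j (x * y) = (u ^ i x * t ^ j x) * (u ^ i y * t ^ j y)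
    rw [h2, hφ, pow_mul_pow_mul_of_mul_eq htu]

theorem Subgroup.exists_of_card_eq_two {G : Type*} [Group G] {J : Subgroup G}
    (hJ : Nat.card J = 2) : ∃ j ∈ J, j ≠ 1 ∧ j ^ 2 = 1 ∧ ∀ z ∈ J, z = 1 ∨ z = j := by
  obtain ⟨j, hj, huniq⟩ := (Nat.card_eq_two_iff' (1 : J)).1 hJ
  refine ⟨j, j.2, fun h => hj (Subtype.ext h), ?_, fun z hz => ?_⟩
  · have := congrArg Subtype.val (pow_card_eq_one' (x := j))
    rwa [hJ] at this
  · by_contra! h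
    exact h.2 (congrArg Subtype.val (huniq ⟨z, hz⟩ fun h' => h.1 (congrArg Subtype.val h')))

section CyclicIndexTwo

variable {G : Type*} [Group G] {g : G} {e : ℕ}

theorem index_zpowers_eq_two (hG : Nat.card G = 2 * 2 ^ e) (hg : orderOf g = 2 ^ e) :
    (Subgroup.zpowers g).index = 2 := by
  have := Subgroup.card_mul_index (Subgroup.zpowers g)
  rw [Nat.card_zpowers, hg, hG, mul_comm] at this
  exact Nat.eq_of_mul_eq_mul_right (by positivity) this

theorem exists_eq_pow_of_mem_zpowers [Finite G] {x : G} (hx : x ∈ Subgroup.zpowers g) :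
    ∃ i : ℕ, x = g ^ i := by
  obtain ⟨i, hi⟩ := Submonoid.mem_powers_iff _ _ |>.1 (mem_powers_iff_mem_zpowers.2 hx)
  exact ⟨i, hi.symm⟩

theorem exists_rep_of_index_two [Finite G] (hind : (Subgroup.zpowers g).index = 2) {τ : G}
    (hτ : τ ∉ Subgroup.zpowers g) (x : G) :
    ∃ i j : ℕ, x = g ^ i * τ ^ j ∧ (j = 0 ∨ j = 1) := by
  by_cases hx : x ∈ Subgroup.zpowers g
  · obtain ⟨i, rfl⟩ := exists_eq_pow_of_mem_zpowers hx
    exact ⟨i, 0, by simp, Or.inl rfl⟩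
  · have : x * τ⁻¹ ∈ Subgroup.zpowers g := by
      rw [Subgroup.mul_mem_iff_of_index_two hind, inv_mem_iff]
      exact iff_of_false hx hτ
    obtain ⟨i, hi⟩ := exists_eq_pow_of_mem_zpowers this
    exact ⟨i, 1, by rw [← hi]; simp, Or.inr rfl⟩

theorem exists_mul_eq_pow_mul [Finite G] (hind : (Subgroup.zpowers g).index = 2) (τ : G) :
    ∃ k : ℕ, τ * g = g ^ k * τ := by
  have := Subgroup.normal_of_index_eq_two hind
  obtain ⟨k, hk⟩ := exists_eq_pow_of_mem_zpowers (this.conj_mem g (Subgroup.mem_zpowers g) τ)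
  exact ⟨k, by rw [← hk]; group⟩

theorem two_pow_dvd_of_pow_sq (he : 1 ≤ e) (hg : orderOf g = 2 ^ e) {i : ℕ}
    (h : (g ^ i) ^ 2 = 1) : 2 ^ (e - 1) ∣ i := by
  rw [← pow_mul, ← orderOf_dvd_iff_pow_eq_one, hg] at h
  rw [show 2 ^ e = 2 ^ (e - 1) * 2 by rw [← pow_succ]; congr 1; lia] at h
  exact Nat.dvd_of_mul_dvd_mul_right (by lia) h

theorem eq_one_or_eq_of_sq_eq_one [Finite G] (he : 1 ≤ e) (hg : orderOf g = 2 ^ e) {z : G}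
    (hz : z ∈ Subgroup.zpowers g) (hz2 : z ^ 2 = 1) : z = 1 ∨ z = g ^ 2 ^ (e - 1) := by
  obtain ⟨i, rfl⟩ := exists_eq_pow_of_mem_zpowers hz
  obtain ⟨c, rfl⟩ := two_pow_dvd_of_pow_sq he hg hz2
  have hw : (g ^ 2 ^ (e - 1)) ^ 2 = 1 := by
    rw [← pow_mul, ← pow_succ, Nat.sub_add_cancel he, ← hg, pow_orderOf_eq_one]
  rw [pow_mul, pow_eq_pow_mod c hw]
  rcases Nat.mod_two_eq_zero_or_one c with h | h <;> simp [h]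

/-- Conjugating twice by the involution `τ` is trivial, but raises `g` to the power `k ^ 2`. -/
theorem sq_modEq_one {τ : G} {k : ℕ} (hτ2 : τ ^ 2 = 1) (hrel : τ * g = g ^ k * τ) :
    k ^ 2 ≡ 1 [MOD orderOf g] := by
  have := pow_mul_pow_of_mul_eq hrel 1 2
  rw [hτ2, one_mul, mul_one, mul_one] at this
  exact pow_eq_pow_iff_modEq.1 this.symm

end CyclicIndexTwo

/-- The permutation `y ↦ a * y + b` of `ZMod n`. -/
def affinePerm {n : ℕ} (a : (ZMod n)ˣ) (b : ZMod n) : Equiv.Perm (ZMod n) :=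
  a.mulLeft.trans (Equiv.addRight b)

@[simp] theorem affinePerm_apply {n : ℕ} (a : (ZMod n)ˣ) (b y : ZMod n) :
    affinePerm a b y = a * y + b := rfl

theorem affinePerm_pow_apply {n : ℕ} (a : (ZMod n)ˣ) (b y : ZMod n) (m : ℕ) :
    (affinePerm a b ^ m) y = (a : ZMod n) ^ m * y + (∑ i ∈ Finset.range m, (a : ZMod n) ^ i) * b := by
  induction m with
  | zero => simp
  | succ m ih =>
    rw [pow_succ', Equiv.Perm.mul_apply, ih, geom_sum_succ, affinePerm_apply]; ring

/-! ### Affine actions with a prescribed stabilizer of order two -/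

namespace AffineAction

variable {G : Type*} [Group G] [Finite G] {e : ℕ}

/-- The affine action of `G` attached to a pair of affine permutations satisfying the relations of
the generators `g`, `τ` of `G`, with prescribed stabilizer. -/
theorem exists_of_relations {g τ : G} {k : ℕ} (hG : Nat.card G = 2 * 2 ^ e)
    (hg : orderOf g = 2 ^ e) (hτ : τ ∉ Subgroup.zpowers g) (hτ2 : τ ^ 2 = 1)
    (hrel : τ * g = g ^ k * τ) {a c : (ZMod (2 ^ e))ˣ} {b d : ZMod (2 ^ e)}
    (hu : affinePerm a b ^ 2 ^ e = 1) (ht : affinePerm c d ^ 2 = 1)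
    (htu : affinePerm c d * affinePerm a b = affinePerm a b ^ k * affinePerm c d)
    {J : Subgroup G} (hJ : Nat.card J = 2)
    (h0 : ∀ i : ℕ, (affinePerm a b ^ i) 0 = 0 ↔ g ^ i ∈ J)
    (h1 : ∀ i : ℕ, (affinePerm a b ^ i) d = 0 ↔ g ^ i * τ ∈ J) :
    ∃ A : AffineAction G (2 ^ e), A.Transitive ∧ A.stabilizer = J := by
  have hind := index_zpowers_eq_two hG hg
  have hrep := exists_rep_of_index_two hind hτ
  obtain ⟨φ, hφ⟩ := exists_monoidHom_of_relations hτ hτ2 hrel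
    (fun x => (hrep x).imp fun i => Exists.imp fun j => And.left) (hg.symm ▸ hu) ht htu
  have haff : ∀ x, ∃ a b, ∀ y, φ x y = a * y + b := by
    intro x
    obtain ⟨i, j, rfl, -⟩ := hrep x
    rw [hφ]
    refine ⟨(a : ZMod (2 ^ e)) ^ i * (c : ZMod (2 ^ e)) ^ j,
      (a : ZMod (2 ^ e)) ^ i * ((∑ l ∈ Finset.range j, (c : ZMod (2 ^ e)) ^ l) * d) +
        (∑ l ∈ Finset.range i, (a : ZMod (2 ^ e)) ^ l) * b, fun y => ?_⟩
    rw [Equiv.Perm.mul_apply, affinePerm_pow_apply, affinePerm_pow_apply, mul_add, ← mul_assoc,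
      add_assoc]
  have hS : (ofPerm φ haff).stabilizer = J := by
    ext x
    rw [mem_stabilizer, ofPerm_b]
    obtain ⟨i, j, rfl, rfl | rfl⟩ := hrep x
    · rw [hφ]; simpa using h0 i
    · rw [hφ]; simpa using h1 i
  refine ⟨_, transitive_of_index _ ?_, hS⟩
  have := Subgroup.card_mul_index J
  rw [hJ, hG] at this
  rw [hS]
  exact Nat.eq_of_mul_eq_mul_left two_pos this

/-- Let `g` act as `y ↦ y + 1` and `τ` as `y ↦ k * y`, where `τ * g * τ⁻¹ = g ^ k`. -/
theorem exists_of_not_mem_zpowers {g τ : G} (hG : Nat.card G = 2 * 2 ^ e)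
    (hg : orderOf g = 2 ^ e) (hτ : τ ∉ Subgroup.zpowers g) (hτ2 : τ ^ 2 = 1)
    {J : Subgroup G} (hJ : ∀ z, z ∈ J ↔ z = 1 ∨ z = τ) (hJ2 : Nat.card J = 2) :
    ∃ A : AffineAction G (2 ^ e), A.Transitive ∧ A.stabilizer = J := by
  obtain ⟨k, hk⟩ := exists_mul_eq_pow_mul (index_zpowers_eq_two hG hg) τ
  have hk2 : (k : ZMod (2 ^ e)) ^ 2 = 1 := by
    have := (ZMod.natCast_eq_natCast_iff _ _ _).2 (hg ▸ sq_modEq_one hτ2 hk)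
    simpa using this
  let κ : (ZMod (2 ^ e))ˣ := ⟨k, k, by rw [← sq, hk2], by rw [← sq, hk2]⟩
  have hκ : (κ : ZMod (2 ^ e)) = k := rfl
  have hpow : ∀ (i : ℕ) y, (affinePerm (1 : (ZMod (2 ^ e))ˣ) 1 ^ i) y = y + i := fun i y => by
    simp [affinePerm_pow_apply]
  have hgi : ∀ i : ℕ, (i : ZMod (2 ^ e)) = 0 ↔ g ^ i = 1 := fun i => by
    rw [ZMod.natCast_eq_zero_iff, ← hg, orderOf_dvd_iff_pow_eq_one]
  have hmem : ∀ i : ℕ, g ^ i ∈ Subgroup.zpowers g := fun i =>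
    Subgroup.pow_mem _ (Subgroup.mem_zpowers g) i
  refine exists_of_relations hG hg hτ hτ2 hk (a := 1) (b := 1) (c := κ) (d := 0) ?_ ?_ ?_ hJ2 ?_ ?_
  · ext y : 1; rw [hpow]; simp
  · ext y : 1
    simp only [affinePerm_pow_apply, hκ, hk2]; simp
  · ext y : 1
    simp [hpow, hκ, mul_add]
  · intro i
    rw [hpow, zero_add, hgi, hJ]
    exact ⟨Or.inl, fun h => h.resolve_right fun h' => hτ (h' ▸ hmem i)⟩
  · intro i
    rw [hpow, zero_add, hgi, hJ, mul_eq_right]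
    refine ⟨Or.inr, fun h => h.resolve_left fun h' => hτ ?_⟩
    rw [← inv_mem_iff, ← eq_inv_of_mul_eq_one_left h']
    exact hmem i

/-- Writing `k = 2 * c + 1` turns the hypothesis into `2 ^ (e - 2) ∣ c * (c + 1)`; one factor is
odd, so the other absorbs the whole power. -/
theorem modEq_one_or_neg_one {k : ℤ} (he : 2 ≤ e) (hk : (2 : ℤ) ^ e ∣ k ^ 2 - 1) :
    (2 : ℤ) ^ (e - 1) ∣ k - 1 ∨ (2 : ℤ) ^ (e - 1) ∣ k + 1 := by
  obtain ⟨f, rfl⟩ : ∃ f, e = f + 2 := ⟨e - 2, by lia⟩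
  have hodd : Odd k := by
    have h2 : (2 : ℤ) ∣ k ^ 2 - 1 := (dvd_pow_self 2 (by lia)).trans hk
    by_contra h
    rw [Int.not_odd_iff_even] at h
    obtain ⟨c, rfl⟩ := h
    obtain ⟨d, hd⟩ := h2
    have : (c + c) ^ 2 = 2 * (2 * c ^ 2) := by ring
    lia
  obtain ⟨c, rfl⟩ := hodd
  have h4 : (2 : ℤ) ^ f ∣ c * (c + 1) := by
    rw [pow_add] at hk
    exact (mul_dvd_mul_iff_right (show (2 : ℤ) ^ 2 ≠ 0 by norm_num)).1 (by convert! hk using 1; ring)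
  have hco : IsCoprime c (c + 1) := ⟨-1, 1, by ring⟩
  have hs : f + 2 - 1 = f + 1 := by lia
  rw [hs, show 2 * c + 1 - 1 = c * 2 by ring, show 2 * c + 1 + 1 = (c + 1) * 2 by ring, pow_succ]
  rcases Int.even_or_odd c with h | h
  · left
    refine mul_dvd_mul_right (IsCoprime.dvd_of_dvd_mul_right ?_ h4) _
    refine IsCoprime.pow_left ?_
    obtain ⟨d, rfl⟩ := h
    exact ⟨-d, 1, by ring⟩
  · right
    refine mul_dvd_mul_right (IsCoprime.dvd_of_dvd_mul_left ?_ h4) _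
    refine IsCoprime.pow_left ?_
    obtain ⟨d, rfl⟩ := h
    exact ⟨-d, 1, by ring⟩

/-- Here `J` is generated by `g ^ 2 ^ (e - 1)`, which must act trivially, so only `k` mod `2 ^ (e -
1)` matters, and that is `1` or `-1`. Let `g` act as `y ↦ a * y + 2` with `a ≡ 1 mod 4`, moving `0`
through all even labels, and let `τ` act as `y ↦ 1 - y`, exchanging the parities. -/
theorem exists_of_mem_zpowers {g τ j : G} (he : 2 ≤ e) (hG : Nat.card G = 2 * 2 ^ e)
    (hg : orderOf g = 2 ^ e) (hτ : τ ∉ Subgroup.zpowers g) (hτ2 : τ ^ 2 = 1)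
    (hj : j ∈ Subgroup.zpowers g) (hj1 : j ≠ 1) (hj2 : j ^ 2 = 1)
    {J : Subgroup G} (hJ : ∀ z, z ∈ J ↔ z = 1 ∨ z = j) (hJ2 : Nat.card J = 2) :
    ∃ A : AffineAction G (2 ^ e), A.Transitive ∧ A.stabilizer = J := by
  obtain ⟨k, hk⟩ := exists_mul_eq_pow_mul (index_zpowers_eq_two hG hg) τ
  have hjw : j = g ^ 2 ^ (e - 1) :=
    (eq_one_or_eq_of_sq_eq_one (by lia) hg hj hj2).resolve_left hj1
  have hk2 : (2 : ℤ) ^ (e - 1) ∣ k - 1 ∨ (2 : ℤ) ^ (e - 1) ∣ k + 1 := by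
    refine modEq_one_or_neg_one he ?_
    have := (Nat.modEq_iff_dvd.1 (hg ▸ (sq_modEq_one hτ2 hk).symm))
    simpa using this
  -- For `a ≡ 1 mod 4` the map `y ↦ a * y + 2` has order `2 ^ (e - 1)`, and this is already the
  -- period of `0`.
  have key : ∀ (x : ℤ) (a : (ZMod (2 ^ e))ˣ), x % 4 = 1 → (x : ZMod (2 ^ e)) = a →
      (affinePerm a 2 ^ 2 ^ (e - 1) = 1) ∧
      ∀ i : ℕ, (affinePerm a 2 ^ i) 0 = 0 ↔ 2 ^ (e - 1) ∣ i := by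
    intro x a hx hxa
    have hx' : Odd x := Int.odd_iff.2 (by lia)
    have hone : affinePerm a 2 ^ 2 ^ (e - 1) = 1 := by
      ext y : 1
      rw [affinePerm_pow_apply, ← hxa]
      have h1 := (intCast_eq_zero_iff (e := e) _).2 ((pow_dvd_pow 2 (by lia)).trans
        (four_mul_two_pow_dvd_pow_sub_one hx' (k := e - 1) (by lia)))
      have h2 := (intCast_eq_zero_iff (e := e) _).2
        (show (2 : ℤ) ^ e ∣ (∑ i ∈ Finset.range (2 ^ (e - 1)), x ^ i) * 2 by
          conv_lhs => rw [show e = (e - 1) + 1 by lia, pow_succ]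
          exact mul_dvd_mul_right (two_pow_dvd_geom_sum hx' _) _)
      push_cast at h1 h2
      rw [sub_eq_zero] at h1
      rw [h1, h2]; simp
    refine ⟨hone, fun i => ?_⟩
    have hper : Function.minimalPeriod (affinePerm a 2) 0 = 2 ^ ((e - 2) + 1) := by
      refine Function.minimalPeriod_eq_prime_pow ?_ ?_
      · rw [Function.IsPeriodicPt, Function.IsFixedPt, ← Equiv.Perm.coe_pow, affinePerm_pow_apply,
          ← hxa, mul_zero, zero_add]
        intro h
        have h' := (intCast_eq_zero_iff (e := e)
          ((∑ i ∈ Finset.range (2 ^ (e - 2)), x ^ i) * 2)).1 (by push_cast; exact h)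
        obtain ⟨c, hc, hs⟩ := geom_sum_two_pow_eq hx (e - 2)
        rw [hs, show (2 : ℤ) ^ (e - 2) * c * 2 = 2 ^ (e - 2 + 1) * c by ring] at h'
        exact not_two_pow_dvd hc (by lia) h'
      · rw [show e - 2 + 1 = e - 1 by lia, Function.IsPeriodicPt, Function.IsFixedPt,
          ← Equiv.Perm.coe_pow, hone]; rfl
    rw [show e - 1 = e - 2 + 1 by lia, ← hper, ← Function.isPeriodicPt_iff_minimalPeriod_dvd,
      Function.IsPeriodicPt, Function.IsFixedPt, ← Equiv.Perm.coe_pow]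
  have main : ∀ (x : ℤ) (a : (ZMod (2 ^ e))ˣ), x % 4 = 1 → (x : ZMod (2 ^ e)) = a →
      affinePerm (-1) 1 * affinePerm a 2 = affinePerm a 2 ^ k * affinePerm (-1) 1 →
      ∃ A : AffineAction G (2 ^ e), A.Transitive ∧ A.stabilizer = J := by
    intro x a hx hxa hrel
    obtain ⟨hone, hper⟩ := key x a hx hxa
    refine exists_of_relations hG hg hτ hτ2 hk (a := a) (b := 2) (c := -1) (d := 1) ?_ ?_ hrel
      hJ2 ?_ ?_
    · rw [← orderOf_dvd_iff_pow_eq_one] at hone ⊢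
      exact hone.trans (pow_dvd_pow 2 (by lia))
    · ext y : 1
      simp [pow_two]
    · intro i
      rw [hper, hJ]
      constructor
      · rintro ⟨c, rfl⟩
        rw [pow_mul, ← hjw, pow_eq_pow_mod c hj2]
        rcases Nat.mod_two_eq_zero_or_one c with h | h <;> simp [h]
      · intro h
        refine two_pow_dvd_of_pow_sq (by lia) hg ?_
        rcases h with h | h <;> simp [h, hj2]
    · intro i
      -- Modulo 2, `g` preserves parity and `τ` changes it, so `g ^ i * τ` never fixes `0`.
      refine iff_of_false (fun h => ?_) fun h => hτ ?_
      · have h2 := congrArg (ZMod.castHom (dvd_pow_self 2 (show e ≠ 0 by lia)) (ZMod 2)) h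
        rw [affinePerm_pow_apply, ← hxa] at h2
        have hx2 : ((x : ℤ) : ZMod 2) = 1 := by
          rw [← Int.cast_one, ZMod.intCast_eq_intCast_iff]
          exact show x % 2 = 1 % 2 by lia
        simp only [map_add, map_mul, map_pow, map_intCast, hx2, map_one, map_ofNat, one_pow,
          map_zero, show (2 : ZMod 2) = 0 from rfl] at h2
        simp at h2
      · have : g ^ i * τ ∈ Subgroup.zpowers g := by
          rcases (hJ _).1 h with h | h
          · rw [h]; exact Subgroup.one_mem _
          · rw [h]; exact hj
        exact (Subgroup.mul_mem_cancel_left _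
          (Subgroup.pow_mem _ (Subgroup.mem_zpowers g) i)).1 this
  rcases hk2 with hk2 | hk2
  -- When `k ≡ 1` the two maps must commute: comparing `1 - (a * y + 2)` with `a * (1 - y) + 2`
  -- gives `a = -3`.
  · let a : (ZMod (2 ^ e))ˣ := -ZMod.unitOfCoprime 3 (Nat.Coprime.pow_right e (by norm_num))
    have ha : (a : ZMod (2 ^ e)) = -3 := by simp [a]
    refine main (-3) a rfl (by simp [ha]) ?_
    have h1 : affinePerm a 2 ^ k = affinePerm a 2 ^ 1 := by
      refine (pow_eq_pow_iff_modEq.2 (Nat.ModEq.of_dvd (orderOf_dvd_of_pow_eq_one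
        (key (-3) a rfl (by simp [ha])).1) (Nat.modEq_iff_dvd.2 ?_))).symm
      simpa using hk2
    rw [h1, pow_one]
    ext y : 1
    simp [ha]; ring
  -- When `k ≡ -1`, `a = 1` works, since `y ↦ 1 - y` inverts translations.
  · refine main 1 1 rfl (by simp) ?_
    have h1 : affinePerm (1 : (ZMod (2 ^ e))ˣ) 2 ^ (k + 1) = 1 :=
      orderOf_dvd_iff_pow_eq_one.1 ((orderOf_dvd_of_pow_eq_one (key 1 1 rfl (by simp)).1).trans
        (by exact_mod_cast hk2))
    have h2 : affinePerm (-1) 1 = affinePerm (1 : (ZMod (2 ^ e))ˣ) 2 *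
        (affinePerm (-1) 1 * affinePerm 1 2) := by
      ext y : 1
      simp; ring
    conv_rhs => rw [h2, ← mul_assoc, ← pow_succ, h1, one_mul]

/-- If `G` is a faithful transitive group of affine maps of `ZMod (2 ^ e)` of order `2 ^ (e + 1)`
with an element of order `2 ^ e`, then every subgroup of order two is the stabilizer of a point in
some transitive affine action. -/
theorem exists_stabilizer_eq (A : AffineAction G (2 ^ e)) (hA : A.Faithful) (hT : A.Transitive)
    (hG : Nat.card G = 2 * 2 ^ e) {g : G} (hg : orderOf g = 2 ^ e) {J : Subgroup G}
    (hJ2 : Nat.card J = 2) :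
    ∃ A' : AffineAction G (2 ^ e), A'.Transitive ∧ A'.stabilizer = J := by
  have he : 2 ≤ e := by
    rcases Nat.eq_zero_or_pos e with rfl | he
    · have h1 : ∀ z : G, z = 1 := fun z =>
        hA z (Subsingleton.elim (α := ZMod 1) _ _) (Subsingleton.elim (α := ZMod 1) _ _)
      have : Subsingleton G := ⟨fun x y => (h1 x).trans (h1 y).symm⟩
      rw [Nat.card_unique] at hG
      simp at hG
    · exact (A.two_pow_succ_dvd_card_ker hA (s := 1) he (by simpa using hG)).2
  have hind := index_zpowers_eq_two hG hg
  have hJ : ∀ {S : Subgroup G}, Nat.card S = 2 →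
      ∃ j, j ≠ 1 ∧ j ^ 2 = 1 ∧ ∀ z, z ∈ S ↔ z = 1 ∨ z = j := fun hS => by
    obtain ⟨j, hjS, h1, h2, h⟩ := Subgroup.exists_of_card_eq_two hS
    exact ⟨j, h1, h2, fun z => ⟨h z, by rintro (rfl | rfl); exacts [Subgroup.one_mem _, hjS]⟩⟩
  obtain ⟨j, hj1, hj2, hj⟩ := hJ hJ2
  by_cases hjC : j ∈ Subgroup.zpowers g
  · have hS2 : Nat.card A.stabilizer = 2 := by
      have := Subgroup.card_mul_index A.stabilizer
      rw [A.index_stabilizer hT, hG] at this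
      exact Nat.eq_of_mul_eq_mul_right (by positivity) this
    obtain ⟨τ, hτ1, hτ2, hτ⟩ := hJ hS2
    have hbτ : A.b τ = 0 := (hτ τ).2 (Or.inr rfl)
    refine exists_of_mem_zpowers he hG hg (fun hτC => hτ1 (hA τ ?_ hbτ)) hτ2 hjC hj1 hj2 hj hJ2
    have hn := Subgroup.normal_of_index_eq_two hind
    -- If `τ` were in `⟨g⟩`, it would be the only involution of a normal cyclic subgroup, hence
    -- central. A central element fixing `0` fixes every point of a transitive action.
    have hcomm : ∀ h : G, τ * h = h * τ := fun h => by
      have h1 := (eq_one_or_eq_of_sq_eq_one (by lia) hg hτC hτ2).resolve_left hτ1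
      have h2 := (eq_one_or_eq_of_sq_eq_one (by lia) hg (hn.conj_mem τ hτC h)
        (by rw [conj_pow, hτ2]; simp)).resolve_left (by simpa using hτ1)
      rw [← h1] at h2
      nth_rw 1 [← h2]
      group
    obtain ⟨h, hh⟩ := hT 1
    have := congrArg A.b (hcomm h)
    rwa [A.b_mul, A.b_mul, hbτ, hh, mul_one, add_zero, mul_zero, zero_add] at this
  · exact exists_of_not_mem_zpowers hG hg hjC hj2 hj hJ2

end AffineAction

/-! ### From Hopf-Galois structures of cyclic type to affine actions -/

theorem addMonoidHom_zmod_apply {n : ℕ} [NeZero n] (f : ZMod n →+ ZMod n) (i : ZMod n) :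
    f i = f 1 * i := by
  conv_lhs => rw [← ZMod.natCast_zmod_val i, ← nsmul_one, map_nsmul]
  rw [nsmul_eq_mul, ZMod.natCast_zmod_val, mul_comm]

namespace HopfGaloisStructure

variable {K L H M E : Type*} [Field K] [Field L] [Algebra K L] [Ring H] [HopfAlgebra K H]
  (S : HopfGaloisStructure K L H) [Field M] [Algebra K M] [Field E] [Algebra K E]

/-- For an embedding `x : L → E`, the map `E ⊗ H → Hom_K(L, E)`, `m ⊗ h ↦ (l ↦ m * x (h l))`. -/
noncomputable def evalEmbedding (x : L →ₐ[K] E) : E ⊗[K] H →ₗ[E] (L →ₗ[K] E) :=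
  LinearMap.liftBaseChange E (LinearMap.compRight K x.toLinearMap ∘ₗ S.action.toLinearMap)

@[simp] theorem evalEmbedding_tmul (x : L →ₐ[K] E) (m : E) (h : H) (l : L) :
    S.evalEmbedding x (m ⊗ₜ h) l = m * x (S.action h l) := by
  simp [evalEmbedding]

theorem evalEmbedding_map (x : L →ₐ[K] E) (t : L ⊗[K] H) (l : L) :
    S.evalEmbedding x (TensorProduct.map x.toLinearMap LinearMap.id t) l =
      x ((LinearMap.mul' K (Module.End K L) ∘ₗ
        TensorProduct.map (Algebra.lmul K L).toLinearMap S.action.toLinearMap) t l) := by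
  induction t with
  | zero => simp
  | add a b ha hb => simp only [map_add, LinearMap.add_apply, ha, hb]
  | tmul l' h => simp

theorem evalEmbedding_mul_tmul (x : L →ₐ[K] E) (z : E ⊗[K] H) (m : E) (h : H) (l : L) :
    S.evalEmbedding x (z * m ⊗ₜ h) l = m * S.evalEmbedding x z (S.action h l) := by
  induction z with
  | zero => simp
  | add a b ha hb => simp only [map_add, add_mul, LinearMap.add_apply, ha, hb, mul_add]
  | tmul m' h' => simp [Algebra.TensorProduct.tmul_mul_tmul]; ring

/-- If `z` carries the embedding `x` to `y`, then `z * z'` acts at `x` as `z'` does at `y`; this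
makes the group-like elements act on embeddings from the right. -/
theorem evalEmbedding_mul {x y : L →ₐ[K] E} {z : E ⊗[K] H}
    (hz : S.evalEmbedding x z = y.toLinearMap) (z' : E ⊗[K] H) :
    S.evalEmbedding x (z * z') = S.evalEmbedding y z' := by
  induction z' with
  | zero => simp
  | add a b ha hb => simp only [map_add, mul_add, ha, hb]
  | tmul m' h' => ext l; rw [evalEmbedding_mul_tmul, hz, evalEmbedding_tmul]; rfl

theorem evalEmbedding_comp (x : L →ₐ[K] E) (σ : E →ₐ[K] E) (z : E ⊗[K] H) (l : L) :
    S.evalEmbedding (σ.comp x) (Algebra.TensorProduct.map σ (AlgHom.id K H) z) l =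
      σ (S.evalEmbedding x z l) := by
  induction z with
  | zero => simp
  | add a b ha hb => simp only [map_add, LinearMap.add_apply, ha, hb]
  | tmul m' h' => simp

section Finite

variable [FiniteDimensional K L]

theorem finrank_eq (S : HopfGaloisStructure K L H) : Module.finrank K H = Module.finrank K L := by
  have := S.finite
  have h := (LinearEquiv.ofBijective _ S.galois).finrank_eq
  rw [Module.finrank_tensorProduct, Module.finrank_linearMap] at h
  exact Nat.eq_of_mul_eq_mul_left Module.finrank_pos h

/-- By the Galois condition every rank-one map `l ↦ coord i l` of `L` comes from `L ⊗ H`; composed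
with `x`, these span `Hom_K(L, E)` over `E`. -/
theorem evalEmbedding_surjective (x : L →ₐ[K] E) : Function.Surjective (S.evalEmbedding x) := by
  rw [← LinearMap.range_eq_top, eq_top_iff]
  intro F _
  let b := Module.finBasis K L
  have hF : F = ∑ i, F (b i) • (x.toLinearMap ∘ₗ (b.coord i).smulRight (1 : L)) := by
    refine b.ext fun j => ?_
    simp [LinearMap.sum_apply, Finsupp.single_apply, apply_ite]
  rw [hF]
  refine Submodule.sum_mem _ fun i _ => Submodule.smul_mem _ _ ?_
  obtain ⟨t, ht⟩ := S.galois.2 ((b.coord i).smulRight (1 : L))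
  refine ⟨TensorProduct.map x.toLinearMap LinearMap.id t, ?_⟩
  ext l
  rw [evalEmbedding_map, ht]; rfl

theorem evalEmbedding_injective (x : L →ₐ[K] E) : Function.Injective (S.evalEmbedding x) := by
  have := S.finite
  refine (LinearMap.injective_iff_surjective_of_finrank_eq_finrank ?_).2
    (S.evalEmbedding_surjective x)
  rw [Module.finrank_baseChange, Module.finrank_linearMap, S.finrank_eq, Module.finrank_self,
    mul_one]

end Finite

/-! ### Group-like elements acting on embeddings -/

section GroupLike

variable [Algebra M E] [IsScalarTower K M E]

/-- Extension of scalars `M ⊗ H → E ⊗ H`. -/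
noncomputable def extendScalars (K H M E : Type*) [Field K] [Ring H] [HopfAlgebra K H] [Field M]
    [Algebra K M] [Field E] [Algebra K E] [Algebra M E] [IsScalarTower K M E] :
    M ⊗[K] H →ₐ[K] E ⊗[K] H :=
  Algebra.TensorProduct.map (IsScalarTower.toAlgHom K M E) (AlgHom.id K H)

theorem extendScalars_injective : Function.Injective (extendScalars K H M E) :=
  Module.Flat.rTensor_preserves_injective_linearMap (M := H)
    (IsScalarTower.toAlgHom K M E).toLinearMap (algebraMap M E).injective

/-- Evaluation `M ⊗ H → E` of the action at `l`, followed by an embedding `x : L → E`. -/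
noncomputable def evalAt (M : Type*) [Field M] [Algebra K M] [Algebra M E] [IsScalarTower K M E]
    (x : L →ₐ[K] E) (l : L) : M ⊗[K] H →ₗ[M] E :=
  LinearMap.liftBaseChange M (x.toLinearMap ∘ₗ LinearMap.applyₗ l ∘ₗ S.action.toLinearMap)

theorem evalAt_tmul (x : L →ₐ[K] E) (l : L) (m : M) (h : H) :
    S.evalAt M x l (m ⊗ₜ h) = algebraMap M E m * x (S.action h l) := by
  simp [evalAt, Algebra.smul_def]

theorem evalEmbedding_extendScalars (x : L →ₐ[K] E) (z : M ⊗[K] H) (l : L) :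
    S.evalEmbedding x (extendScalars K H M E z) l = S.evalAt M x l z := by
  induction z with
  | zero => simp
  | add a b ha hb => simp only [map_add, LinearMap.add_apply, ha, hb]
  | tmul m h => rw [evalAt_tmul]; simp [extendScalars]

theorem evalAt_one (x : L →ₐ[K] E) (z : M ⊗[K] H) :
    S.evalAt M x 1 z = algebraMap M E (Coalgebra.counit (R := M) z) := by
  induction z with
  | zero => simp
  | add a b ha hb => simp only [map_add, ha, hb]
  | tmul m h =>
    rw [evalAt_tmul, S.action_one, TensorProduct.counit_tmul, AlgHom.commutes, Algebra.smul_def,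
      map_mul, mul_comm, ← IsScalarTower.algebraMap_apply]
    simp

theorem evalAt_mul (x : L →ₐ[K] E) (l l' : L) (z : M ⊗[K] H) :
    S.evalAt M x (l * l') z =
      LinearMap.mul' M E (TensorProduct.map (S.evalAt M x l) (S.evalAt M x l')
        (Coalgebra.comul (R := M) z)) := by
  induction z with
  | zero => simp
  | add a b ha hb => simp only [map_add, ha, hb]
  | tmul m h =>
    rw [evalAt_tmul, S.action_mul, TensorProduct.comul_tmul]
    generalize Coalgebra.comul (R := K) h = t
    induction t with
    | zero => simp
    | add a b ha hb =>
      simp only [map_add, LinearMap.add_apply, TensorProduct.tmul_add, ← ha, ← hb, mul_add]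
    | tmul h₁ h₂ =>
      rw [CommSemiring.comul_apply, TensorProduct.AlgebraTensorModule.tensorTensorTensorComm_tmul]
      simp [evalAt_tmul]; ring

/-- A group-like element of `M ⊗ H` moves an embedding `x : L → E` to another embedding. -/
noncomputable def moveEmbedding (x : L →ₐ[K] E) {z : M ⊗[K] H} (hz : IsGroupLikeElem M z) :
    L →ₐ[K] E :=
  AlgHom.ofLinearMap (S.evalEmbedding x (extendScalars K H M E z))
    (by rw [evalEmbedding_extendScalars, evalAt_one, hz.counit_eq_one, map_one])
    (fun l l' => by
      simp only [evalEmbedding_extendScalars]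
      rw [evalAt_mul, hz.comul_eq_tmul_self]; simp)

variable [FiniteDimensional K L]

theorem card_eq_of_equiv (S : HopfGaloisStructure K L H) {N : Type*} [Group N]
    (Φ : (M ⊗[K] H) ≃ₐc[M] MonoidAlgebra M N) : Nat.card N = Module.finrank K L := by
  rw [← S.finrank_eq, ← Module.finrank_baseChange (R := M),
    (Φ : (M ⊗[K] H) ≃ₐ[M] MonoidAlgebra M N).toLinearEquiv.finrank_eq,
    Module.finrank_eq_nat_card_basis (MonoidAlgebra.basis N M)]

/-- If `L/K` has a Hopf-Galois structure of cyclic type, then the embeddings of `L` into an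
extension `E` of the normal closure can be labelled by `ZMod n` so that the automorphisms of `E`
act by affine maps. -/
theorem exists_equiv_zmod (S : HopfGaloisStructure K L H) {N : Type*} [Group N] [hN : IsCyclic N]
    (Φ : (M ⊗[K] H) ≃ₐc[M] MonoidAlgebra M N)
    (hcard : Nat.card (L →ₐ[K] E) = Module.finrank K L) :
    ∃ f : (L →ₐ[K] E) ≃ ZMod (Module.finrank K L),
      ∀ σ : E ≃ₐ[K] E, ∃ a b, ∀ x, f ((σ : E →ₐ[K] E).comp x) = a * f x + b := by
  have hNcard := S.card_eq_of_equiv Φ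
  have hpos : 0 < Module.finrank K L := Module.finrank_pos
  have : NeZero (Module.finrank K L) := ⟨hpos.ne'⟩
  have : Finite N := Nat.finite_of_card_ne_zero (by lia)
  have : Finite (L →ₐ[K] E) := Nat.finite_of_card_ne_zero (by lia)
  have : Nonempty (L →ₐ[K] E) := Nat.card_pos_iff.1 (by lia) |>.1
  let x₀ : L →ₐ[K] E := Classical.arbitrary _
  have hgl : ∀ η : N, IsGroupLikeElem M (Φ.symm (MonoidAlgebra.of M N η)) := fun η =>
    (MonoidAlgebra.isGroupLikeElem_of η).map Φ.symm
  let ρ : N →* E ⊗[K] H :=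
    ((extendScalars K H M E : M ⊗[K] H →* E ⊗[K] H).comp
      ((Φ : (M ⊗[K] H) ≃ₐ[M] MonoidAlgebra M N).symm : MonoidAlgebra M N →* M ⊗[K] H)).comp
      (MonoidAlgebra.of M N)
  have hρ : Function.Injective ρ := extendScalars_injective.comp
    ((Φ : (M ⊗[K] H) ≃ₐ[M] MonoidAlgebra M N).symm.injective.comp MonoidAlgebra.of_injective)
  let act : (L →ₐ[K] E) → N → (L →ₐ[K] E) := fun x η => S.moveEmbedding x (hgl η)
  have hact : ∀ x η, S.evalEmbedding x (ρ η) = (act x η).toLinearMap := fun x η => rfl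
  have hinj : ∀ x, Function.Injective (act x) := fun x η η' h =>
    hρ (S.evalEmbedding_injective x (by rw [hact, hact, h]))
  -- `N` and the set of embeddings have the same size, so the action of `N` is simply transitive.
  have hbij : ∀ x, Function.Bijective (act x) := fun x =>
    (hinj x).bijective_of_nat_card_le (by rw [hcard, hNcard])
  have hmul : ∀ x η η', act x (η * η') = act (act x η) η' := fun x η η' =>
    AlgHom.toLinearMap_injective (by rw [← hact, ← hact, map_mul, S.evalEmbedding_mul (hact x η)])
  let c : Multiplicative (ZMod (Module.finrank K L)) ≃* N :=
    (MulEquiv.refl _).trans (hNcard ▸ zmodCyclicMulEquiv hN)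
  let f : (L →ₐ[K] E) ≃ ZMod (Module.finrank K L) :=
    (((Multiplicative.ofAdd).trans c.toEquiv).trans (Equiv.ofBijective _ (hbij x₀))).symm
  have hf : ∀ i, f (act x₀ (c (Multiplicative.ofAdd i))) = i := fun i =>
    f.symm.injective (by simp; rfl)
  refine ⟨f, fun σ => ?_⟩
  let σ' : E ⊗[K] H →ₐ[K] E ⊗[K] H := Algebra.TensorProduct.map (σ : E →ₐ[K] E) (AlgHom.id K H)
  have hσ : ∀ x η, S.evalEmbedding ((σ : E →ₐ[K] E).comp x) (σ' (ρ η)) =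
      ((σ : E →ₐ[K] E).comp (act x η)).toLinearMap := fun x η => by
    ext l
    rw [S.evalEmbedding_comp, hact]; rfl
  -- The embedding `σ ∘ (x₀ · η)` equals `(σ ∘ x₀) · η'` for some `η'`, and injectivity of
  -- evaluation then identifies `σ' (ρ η)` with `ρ η'`. So `σ` induces an endomorphism of `N`.
  have hα : ∀ η, ∃ η', ρ η' = σ' (ρ η) := fun η => by
    obtain ⟨η', h⟩ := (hbij ((σ : E →ₐ[K] E).comp x₀)).2 ((σ : E →ₐ[K] E).comp (act x₀ η))
    exact ⟨η', S.evalEmbedding_injective ((σ : E →ₐ[K] E).comp x₀) (by rw [hσ, hact, h])⟩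
  choose α hα using hα
  let α' : N →* N :=
    { toFun := α
      map_one' := hρ (by rw [hα]; simp)
      map_mul' := fun η η' => hρ (by rw [hα, map_mul, map_mul, map_mul, hα, hα]) }
  have hα' : ∀ x η, (σ : E →ₐ[K] E).comp (act x η) = act ((σ : E →ₐ[K] E).comp x) (α' η) :=
    fun x η => AlgHom.toLinearMap_injective (by rw [← hσ, ← hact]; exact congrArg _ (hα η).symm)
  obtain ⟨η₀, hη₀⟩ := (hbij x₀).2 ((σ : E →ₐ[K] E).comp x₀)
  let β : ZMod (Module.finrank K L) →+ ZMod (Module.finrank K L) :=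
    MonoidHom.toAdditive (c.symm.toMonoidHom.comp (α'.comp c.toMonoidHom))
  have hβ : ∀ i, α' (c (Multiplicative.ofAdd i)) = c (Multiplicative.ofAdd (β i)) := fun i =>
    (c.apply_symm_apply _).symm
  -- With `σ ∘ x₀ = x₀ · j`, the embedding labelled `i` goes to label `j + β i`, and an additive
  -- endomorphism of `ZMod n` is multiplication by its value at `1`.
  refine ⟨β 1, c.symm η₀, fun x => ?_⟩
  obtain ⟨η, rfl⟩ := (hbij x₀).2 x
  obtain ⟨i, rfl⟩ := c.surjective η
  obtain ⟨i, rfl⟩ := Multiplicative.ofAdd.surjective i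
  obtain ⟨j, rfl⟩ := c.surjective η₀
  obtain ⟨j, rfl⟩ := Multiplicative.ofAdd.surjective j
  rw [hα', ← hη₀, ← hmul, hβ, ← map_mul, ← ofAdd_add, hf, hf, addMonoidHom_zmod_apply, add_comm,
    c.symm_apply_apply]
  rfl

end GroupLike
end HopfGaloisStructure

/-! ### Galois descent for permutation modules -/

section Descent

variable {K M : Type*} [Field K] [Field M] [Algebra K M] {S : Type*}
  (π : (M ≃ₐ[K] M) →* Equiv.Perm S)

/-- The functions `S → M` that are equivariant for the Galois action on `S` given by `π`. -/
def equivariantFunctions : Submodule K (S → M) where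
  carrier := {w | ∀ σ s, w (π σ s) = σ (w s)}
  add_mem' hv hw σ s := by simp [hv σ s, hw σ s]
  zero_mem' σ s := by simp
  smul_mem' c w hw σ s := by simp [hw σ s]

variable [FiniteDimensional K M]

/-- Multiply an `M`-relation by `m`, apply every `σ` and sum: equivariance turns the coefficients `c
i` into the traces of `m * c i`, which vanish for all `m`. The trace form is nondegenerate. -/
theorem linearIndependent_of_equivariant [IsGalois K M] {ι : Type*} {v : ι → S → M}
    (hv : ∀ i, v i ∈ equivariantFunctions π) (h : LinearIndependent K v) :
    LinearIndependent M v := by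
  rw [linearIndependent_iff'] at h ⊢
  intro s c hc i hi
  refine (traceForm_nondegenerate K M).2 _ fun m => ?_
  refine h s (fun i => Algebra.trace K M (m * c i)) ?_ i hi
  funext t
  have key : ∀ σ : M ≃ₐ[K] M, ∑ i ∈ s, σ (m * c i) * v i t = 0 := fun σ => by
    have h1 := congrArg (fun x => σ (m * x)) (congrFun hc (π σ⁻¹ t))
    simp only [Finset.sum_apply, Pi.smul_apply, smul_eq_mul, Pi.zero_apply, mul_zero, map_zero,
      Finset.mul_sum, map_sum] at h1
    rw [← h1]
    refine Finset.sum_congr rfl fun i _ => ?_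
    have h2 := hv i σ (π σ⁻¹ t)
    rw [← Equiv.Perm.mul_apply, ← map_mul, mul_inv_cancel, map_one, Equiv.Perm.one_apply] at h2
    rw [h2, ← map_mul, mul_assoc]
  simp only [Finset.sum_apply, Pi.smul_apply, Pi.zero_apply]
  simp only [Algebra.smul_def, trace_eq_sum_automorphisms, Finset.sum_mul]
  rw [Finset.sum_comm]
  exact Finset.sum_eq_zero fun σ _ => key σ

/-- A functional killing all equivariant functions kills the averages `∑ σ m • tw σ` for every `m`;
Dedekind's independence of the automorphisms makes it kill each `tw σ`, in particular `tw 1 = w`. -/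
theorem span_equivariantFunctions : Submodule.span M (equivariantFunctions π : Set (S → M)) = ⊤ := by
  by_contra hne
  obtain ⟨φ, hφ0, hφ⟩ := Submodule.exists_le_ker_of_lt_top _ (lt_top_iff_ne_top.2 hne)
  refine hφ0 (LinearMap.ext fun w => ?_)
  let tw : (M ≃ₐ[K] M) → S → M := fun σ s => σ (w (π σ⁻¹ s))
  have hmem : ∀ m : M, (∑ σ : M ≃ₐ[K] M, σ m • tw σ) ∈ equivariantFunctions π := by
    intro m τ s
    simp only [Finset.sum_apply, Pi.smul_apply, smul_eq_mul, map_sum, map_mul, tw]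
    refine (Fintype.sum_equiv (Equiv.mulLeft τ) _ _ fun σ => ?_).symm
    simp [mul_inv_rev]
  have hli := (linearIndependent_toLinearMap K M M).comp
    (fun σ : M ≃ₐ[K] M => (σ : M →ₐ[K] M)) fun σ τ h => AlgEquiv.ext fun m => DFunLike.congr_fun h m
  have := Fintype.linearIndependent_iff.1 hli (fun σ => φ (tw σ)) (LinearMap.ext fun m => by
    have h1 := hφ (Submodule.subset_span (hmem m))
    rw [LinearMap.mem_ker, map_sum] at h1
    simp only [map_smul, smul_eq_mul] at h1
    simp only [LinearMap.sum_apply, LinearMap.smul_apply, Function.comp_apply, smul_eq_mul,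
      LinearMap.zero_apply]
    rw [← h1]
    exact Finset.sum_congr rfl fun σ _ => mul_comm _ _) 1
  have h1 : tw 1 = w := by
    funext s
    simp only [tw, inv_one, map_one, Equiv.Perm.one_apply, AlgEquiv.one_apply]
  rwa [h1] at this

theorem finrank_equivariantFunctions [IsGalois K M] [Fintype S] :
    Module.finrank K (equivariantFunctions π) = Fintype.card S := by
  let b := Module.Free.chooseBasis K (equivariantFunctions π)
  let v := fun i => (b i : S → M)
  have hli : LinearIndependent M v := linearIndependent_of_equivariant π (fun i => (b i).2)
    (b.linearIndependent.map' (equivariantFunctions π).subtype (Submodule.ker_subtype _))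
  have hsp : ⊤ ≤ Submodule.span M (Set.range v) := by
    rw [← span_equivariantFunctions π, Submodule.span_le]
    intro w hw
    have h1 : w ∈ Submodule.span K (Set.range v) := by
      have : (⟨w, hw⟩ : equivariantFunctions π) ∈ Submodule.span K (Set.range b) := by
        rw [b.span_eq]; trivial
      have := Submodule.mem_map_of_mem (f := (equivariantFunctions π).subtype) this
      rwa [Submodule.map_span, ← Set.range_comp] at this
    exact Submodule.span_le_restrictScalars K M _ h1
  rw [Module.finrank_eq_card_basis b, ← Module.finrank_eq_card_basis (Module.Basis.mk hli hsp),
    Module.finrank_fintype_fun_eq_card]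

end Descent

/-- A tensor product of function spaces maps injectively to functions on the product if the left
factor is defined over `K`. -/
theorem injective_of_apply_tmul {K M V T S S' ι : Type*} [Field K] [Field M] [Algebra K M]
    [AddCommGroup V] [Module K V] [AddCommGroup T] [Module K T] (b : Module.Basis ι K V)
    {p : V →ₗ[K] (S → M)} (hp : LinearIndependent M (fun i => p (b i)))
    {g : T →ₗ[K] (S' → M)} (hg : Function.Injective g) (j : V ⊗[K] T →ₗ[K] (S × S' → M))
    (hj : ∀ x t s s', j (x ⊗ₜ t) (s, s') = p x s * g t s') : Function.Injective j := by
  rw [injective_iff_map_eq_zero]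
  intro z hz
  obtain ⟨c, rfl⟩ := TensorProduct.eq_repr_basis_left b z
  suffices c = 0 by simp [this]
  ext i
  rw [Finsupp.zero_apply, ← map_eq_zero_iff g hg]
  funext s'
  by_cases hi : i ∈ c.support
  · refine linearIndependent_iff'.1 hp c.support (fun i => g (c i) s') ?_ i hi
    funext s
    have := congrFun hz (s, s')
    rw [Finsupp.sum, map_sum, Finset.sum_apply] at this
    simp only [hj] at this
    simpa [Finset.sum_apply, mul_comm] using this
  · simp [Finsupp.notMem_support_iff.1 hi]

/-! ### Twisted group algebras -/

namespace TwistedGroupAlgebra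

section Maps

variable (K : Type*) {M N P Q : Type*} [Field K] [Field M] [Algebra K M]
  [CommGroup N] [CommGroup P] [CommGroup Q]

/-- The map of group algebras induced by a homomorphism of groups. -/
noncomputable abbrev pushforward (f : N →* P) : MonoidAlgebra M N →ₐ[K] MonoidAlgebra M P :=
  MonoidAlgebra.mapDomainAlgHom K M f

theorem pushforward_single (f : N →* P) (ν : N) (m : M) :
    pushforward K f (MonoidAlgebra.single ν m) = MonoidAlgebra.single (f ν) m := by
  simp [MonoidAlgebra.mapDomainAlgHom]

theorem pushforward_pushforward (f : P →* Q) (g : N →* P) (x : MonoidAlgebra M N) :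
    pushforward K f (pushforward K g x) = pushforward K (f.comp g) x := by
  rw [pushforward, pushforward, pushforward, MonoidAlgebra.mapDomainAlgHom_comp]; rfl

theorem pushforward_id (x : MonoidAlgebra M N) : pushforward K (MonoidHom.id N) x = x := by
  rw [pushforward, MonoidAlgebra.mapDomainAlgHom_id]; rfl

theorem pushforward_one (x : MonoidAlgebra M N) :
    pushforward K (1 : N →* P) x =
      algebraMap M (MonoidAlgebra M P) (MonoidAlgebra.lift M M N 1 x) := by
  induction x using MonoidAlgebra.induction_linear with
  | zero => simp
  | add x y hx hy => rw [map_add, map_add, map_add, hx, hy]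
  | single ν m => rw [pushforward_single]; simp

theorem coeff_pushforward_inl_mul_inr (x : MonoidAlgebra M N) (y : MonoidAlgebra M P) (s : N)
    (t : P) : (pushforward K (MonoidHom.inl N P) x * pushforward K (MonoidHom.inr N P) y).coeff
      (s, t) = x.coeff s * y.coeff t := by
  classical
  induction x using MonoidAlgebra.induction_linear with
  | zero => simp
  | add x y hx hy =>
    rw [map_add, add_mul, MonoidAlgebra.coeff_add, MonoidAlgebra.coeff_add, Finsupp.add_apply,
      Finsupp.add_apply, hx, hy, add_mul]
  | single ν m =>
    induction y using MonoidAlgebra.induction_linear with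
    | zero => simp
    | add x y hx hy =>
      rw [map_add, mul_add, MonoidAlgebra.coeff_add, MonoidAlgebra.coeff_add, Finsupp.add_apply,
        Finsupp.add_apply, hx, hy, mul_add]
    | single μ m' =>
      rw [pushforward_single, pushforward_single, MonoidAlgebra.single_mul_single]
      simp only [MonoidAlgebra.coeff_single, MonoidHom.inl_apply, MonoidHom.inr_apply,
        Prod.mk_mul_mk, mul_one, one_mul, Finsupp.single_apply, Prod.ext_iff]
      split_ifs <;> simp_all

variable (χ : (M ≃ₐ[K] M) →* MulAut N)

/-- The semilinear action of the Galois group on `M[N]` with the action `χ` on `N`. -/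
noncomputable def galoisAction (σ : M ≃ₐ[K] M) : MonoidAlgebra M N →ₐ[K] MonoidAlgebra M N :=
  (pushforward K (χ σ).toMonoidHom).comp (MonoidAlgebra.mapAlgHom N (σ : M →ₐ[K] M))

theorem galoisAction_single (σ : M ≃ₐ[K] M) (ν : N) (m : M) :
    galoisAction K χ σ (MonoidAlgebra.single ν m) = MonoidAlgebra.single (χ σ ν) (σ m) := by
  rw [galoisAction, AlgHom.comp_apply, MonoidAlgebra.mapAlgHom_single, pushforward_single]; rfl

theorem coeff_galoisAction (σ : M ≃ₐ[K] M) (x : MonoidAlgebra M N) (ν : N) :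
    (galoisAction K χ σ x).coeff (χ σ ν) = σ (x.coeff ν) := by
  classical
  induction x using MonoidAlgebra.induction_linear with
  | zero => simp
  | add x y hx hy => simp [hx, hy]
  | single μ m =>
    rw [galoisAction_single]
    by_cases h : μ = ν <;> simp [h]

/-- The Galois invariants of `M[N]`: the `K`-form of `M[N]` determined by `χ`. -/
noncomputable def _root_.twistedGroupAlgebra : Subalgebra K (MonoidAlgebra M N) :=
  ⨅ σ, AlgHom.equalizer (galoisAction K χ σ) (AlgHom.id K _)

variable {K χ}

theorem mem_iff {x : MonoidAlgebra M N} :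
    x ∈ twistedGroupAlgebra K χ ↔ ∀ σ, galoisAction K χ σ x = x := by
  simp [twistedGroupAlgebra, Algebra.mem_iInf, AlgHom.mem_equalizer]

theorem mem_iff_coeff {x : MonoidAlgebra M N} :
    x ∈ twistedGroupAlgebra K χ ↔ ∀ σ ν, x.coeff (χ σ ν) = σ (x.coeff ν) := by
  rw [mem_iff]
  refine forall_congr' fun σ => ⟨fun h ν => ?_, fun h => ?_⟩
  · rw [← coeff_galoisAction, h]
  · ext ν
    obtain ⟨ν, rfl⟩ := (χ σ).surjective ν
    rw [coeff_galoisAction, h]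

theorem pushforward_mem {χ' : (M ≃ₐ[K] M) →* MulAut P} {f : N →* P}
    (hf : ∀ σ ν, f (χ σ ν) = χ' σ (f ν)) {x : MonoidAlgebra M N}
    (hx : x ∈ twistedGroupAlgebra K χ) : pushforward K f x ∈ twistedGroupAlgebra K χ' := by
  rw [mem_iff] at hx ⊢
  intro σ
  conv_rhs => rw [← hx σ]
  clear hx
  induction x using MonoidAlgebra.induction_linear with
  | zero => simp
  | add x y hx hy => rw [map_add, map_add, map_add, map_add, hx, hy]
  | single ν m =>
    rw [pushforward_single, galoisAction_single, galoisAction_single, pushforward_single, hf]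

variable (χ)

/-- Coefficients of elements of the twisted group algebra. -/
noncomputable def coeffMap : twistedGroupAlgebra K χ →ₗ[K] (N → M) where
  toFun x := x.1.coeff
  map_add' x y := by ext; simp
  map_smul' c x := by ext; simp

theorem coeffMap_injective : Function.Injective (coeffMap χ) := fun _ _ h =>
  Subtype.ext (MonoidAlgebra.ext (DFunLike.ext _ _ fun ν => congrFun h ν))

/-- The permutation action of the Galois group on `N`. -/
def permAction : (M ≃ₐ[K] M) →* Equiv.Perm N := (MulAut.toPerm N).comp χ

theorem coeffMap_mem (x : twistedGroupAlgebra K χ) :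
    coeffMap χ x ∈ equivariantFunctions (permAction χ) := mem_iff_coeff.1 x.2

/-- The twisted group algebra is the space of equivariant functions on `N`. -/
noncomputable def equivEquivariantFunctions [Finite N] :
    twistedGroupAlgebra K χ ≃ₗ[K] equivariantFunctions (permAction χ) :=
  LinearEquiv.ofBijective ((coeffMap χ).codRestrict _ (coeffMap_mem χ))
    ⟨fun _ _ h => coeffMap_injective χ (congrArg Subtype.val h), fun w =>
      ⟨⟨.ofCoeff (Finsupp.equivFunOnFinite.symm w.1), mem_iff_coeff.2 w.2⟩, rfl⟩⟩

variable [FiniteDimensional K M]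

theorem finrank_eq [IsGalois K M] [Finite N] : Module.finrank K (twistedGroupAlgebra K χ) = Nat.card N := by
  have := Fintype.ofFinite N
  rw [(equivEquivariantFunctions χ).finrank_eq, finrank_equivariantFunctions,
    Nat.card_eq_fintype_card]

instance [Finite N] : Module.Finite K (twistedGroupAlgebra K χ) := by
  have := Fintype.ofFinite N
  have : Module.Finite K (N → M) := inferInstance
  exact Module.Finite.of_injective (coeffMap χ) (coeffMap_injective χ)

theorem linearIndependent_coeffMap [IsGalois K M] {ι : Type*} {v : ι → twistedGroupAlgebra K χ}
    (hv : LinearIndependent K v) : LinearIndependent M (fun i => coeffMap χ (v i)) :=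
  linearIndependent_of_equivariant (permAction χ) (fun i => coeffMap_mem χ (v i))
    (hv.map' (coeffMap χ) (LinearMap.ker_eq_bot.2 (coeffMap_injective χ)))

theorem span_eq_top [Finite N] :
    Submodule.span M (twistedGroupAlgebra K χ : Set (MonoidAlgebra M N)) = ⊤ := by
  let q : (N → M) ≃ₗ[M] MonoidAlgebra M N :=
    (Finsupp.linearEquivFunOnFinite M M N).symm.trans (MonoidAlgebra.coeffLinearEquiv M).symm
  have h := congrArg (Submodule.map q.toLinearMap) (span_equivariantFunctions (permAction χ))
  rw [Submodule.map_span, Submodule.map_top, LinearEquiv.range] at h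
  rw [← h]
  congr 1
  ext x
  constructor
  · intro hx
    exact ⟨x.coeff, mem_iff_coeff.1 hx, by ext; simp [q]⟩
  · rintro ⟨w, hw, rfl⟩
    exact mem_iff_coeff.2 hw

/-- The map `H ⊗ T → M[N × P]` for `H` a twisted group algebra and `T → M[P]`. -/
noncomputable def pairMap {T : Type*} [CommRing T] [Algebra K T] (g : T →ₐ[K] MonoidAlgebra M P) :
    twistedGroupAlgebra K χ ⊗[K] T →ₐ[K] MonoidAlgebra M (N × P) :=
  Algebra.TensorProduct.productMap
    ((pushforward K (MonoidHom.inl N P)).comp (twistedGroupAlgebra K χ).val)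
    ((pushforward K (MonoidHom.inr N P)).comp g)

theorem pairMap_tmul {T : Type*} [CommRing T] [Algebra K T] (g : T →ₐ[K] MonoidAlgebra M P)
    (x : twistedGroupAlgebra K χ) (t : T) :
    pairMap χ g (x ⊗ₜ t) = pushforward K (MonoidHom.inl N P) x.1 *
      pushforward K (MonoidHom.inr N P) (g t) := rfl

/-- A `K`-basis of the invariants stays independent over `M`, so coefficients on `N × P` separate
elements of the tensor product over `K`. -/
theorem pairMap_injective [IsGalois K M] {T : Type*} [CommRing T] [Algebra K T]
    {g : T →ₐ[K] MonoidAlgebra M P} (hg : Function.Injective g) :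
    Function.Injective (pairMap χ g) := by
  let coeffP : ∀ Q : Type _, MonoidAlgebra M Q →ₗ[K] (Q → M) := fun Q =>
    { toFun := fun x => x.coeff
      map_add' := fun x y => by ext; simp
      map_smul' := fun c x => by ext; simp }
  let coeffNP : MonoidAlgebra M (N × P) →ₗ[K] (N × P → M) :=
    { toFun := fun x => x.coeff
      map_add' := fun x y => by ext; simp
      map_smul' := fun c x => by ext; simp }
  let b := Module.Free.chooseBasis K (twistedGroupAlgebra K χ)
  refine Function.Injective.of_comp (f := coeffNP) (injective_of_apply_tmul b
    (linearIndependent_coeffMap χ b.linearIndependent) (g := coeffP P ∘ₗ g.toLinearMap) ?_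
    (coeffNP ∘ₗ (pairMap χ g).toLinearMap) fun x t s s' => ?_)
  · intro t t' h
    exact hg (MonoidAlgebra.ext (DFunLike.ext _ _ fun ν => congrFun h ν))
  · exact coeff_pushforward_inl_mul_inr K x.1 (g t) s s'

end Maps

/-! ### The Hopf algebra structure on the invariants -/

section Hopf

variable {K M N : Type*} [Field K] [Field M] [Algebra K M] [FiniteDimensional K M]
  [CommGroup N] (χ : (M ≃ₐ[K] M) →* MulAut N)

/-- The map `H ⊗ H → M[N × N]`. -/
noncomputable abbrev pairMap₂ :
    twistedGroupAlgebra K χ ⊗[K] twistedGroupAlgebra K χ →ₐ[K] MonoidAlgebra M (N × N) :=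
  pairMap χ (twistedGroupAlgebra K χ).val

/-- The map `H ⊗ (H ⊗ H) → M[N × (N × N)]`. -/
noncomputable abbrev pairMap₃ : twistedGroupAlgebra K χ ⊗[K]
      (twistedGroupAlgebra K χ ⊗[K] twistedGroupAlgebra K χ) →ₐ[K]
    MonoidAlgebra M (N × (N × N)) :=
  pairMap χ (T := twistedGroupAlgebra K χ ⊗[K] twistedGroupAlgebra K χ) (pairMap₂ χ)

/-- The diagonal action on `N × N`. -/
def diagAction : (M ≃ₐ[K] M) →* MulAut (N × N) where
  toFun σ := MulEquiv.prodCongr (χ σ) (χ σ)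
  map_one' := by rw [map_one]; rfl
  map_mul' σ τ := by rw [map_mul]; rfl

theorem diagAction_apply (σ : M ≃ₐ[K] M) (ν μ : N) :
    diagAction χ σ (ν, μ) = (χ σ ν, χ σ μ) := rfl

theorem pairMap₂_mem (t : twistedGroupAlgebra K χ ⊗[K] twistedGroupAlgebra K χ) :
    pairMap₂ χ t ∈ twistedGroupAlgebra K (diagAction χ) := by
  induction t with
  | zero => rw [map_zero]; exact Subalgebra.zero_mem _
  | add x y hx hy => rw [map_add]; exact Subalgebra.add_mem _ hx hy
  | tmul x y =>
    rw [pairMap_tmul]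
    exact Subalgebra.mul_mem _ (pushforward_mem (fun σ ν => by simp [diagAction_apply]) x.2)
      (pushforward_mem (fun σ ν => by simp [diagAction_apply]) y.2)

/-- Summation of coefficients. -/
noncomputable def augmentation : MonoidAlgebra M N →ₐ[M] M := MonoidAlgebra.lift M M N 1

theorem augmentation_single (ν : N) (m : M) :
    augmentation (MonoidAlgebra.single ν m) = m := by
  simp [augmentation]

variable [IsGalois K M]

theorem pairMap₂_injective : Function.Injective (pairMap₂ χ) :=
  pairMap_injective χ Subtype.val_injective

theorem pairMap₃_injective : Function.Injective (pairMap₃ χ) :=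
  pairMap_injective χ (T := twistedGroupAlgebra K χ ⊗[K] twistedGroupAlgebra K χ)
    (pairMap₂_injective χ)

variable [Finite N]

/-- Both sides have `K`-dimension `|N| ^ 2`, so the injection of `H ⊗ H` into the invariants of `M[N
× N]` is onto. This is what lets the comultiplication of `M[N]` restrict to `H`. -/
theorem exists_pairMap₂_eq {x : MonoidAlgebra M (N × N)}
    (hx : x ∈ twistedGroupAlgebra K (diagAction χ)) : x ∈ (pairMap₂ χ).range := by
  let j : twistedGroupAlgebra K χ ⊗[K] twistedGroupAlgebra K χ →ₗ[K]
      twistedGroupAlgebra K (diagAction χ) :=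
    ((pairMap₂ χ).codRestrict _ (pairMap₂_mem χ)).toLinearMap
  have hj : Function.Injective j := fun x y h =>
    pairMap₂_injective χ (congrArg Subtype.val h)
  have hs : Function.Surjective j := by
    refine (@LinearMap.injective_iff_surjective_of_finrank_eq_finrank K
      (twistedGroupAlgebra K χ ⊗[K] twistedGroupAlgebra K χ) _ _ _
      (twistedGroupAlgebra K (diagAction χ)) _ _ inferInstance inferInstance ?_ j).1 hj
    rw [Module.finrank_tensorProduct, finrank_eq, finrank_eq, Nat.card_prod]
  obtain ⟨t, ht⟩ := hs ⟨x, hx⟩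
  exact ⟨t, congrArg Subtype.val ht⟩

/-- The diagonal homomorphism `N → N × N`. -/
abbrev diag (N : Type*) [CommGroup N] : N →* N × N := (MonoidHom.id N).prod (MonoidHom.id N)

/-- Comultiplication, the restriction of that of `M[N]`. -/
noncomputable def comulHom : twistedGroupAlgebra K χ →ₐ[K]
    twistedGroupAlgebra K χ ⊗[K] twistedGroupAlgebra K χ :=
  (AlgEquiv.ofInjective (pairMap₂ χ) (pairMap₂_injective χ)).symm.toAlgHom.comp
    (((pushforward K (diag N)).comp (twistedGroupAlgebra K χ).val).codRestrict _ fun x =>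
      exists_pairMap₂_eq χ (pushforward_mem (fun σ ν => by simp [diagAction_apply]) x.2))

theorem pairMap₂_comulHom (x : twistedGroupAlgebra K χ) :
    pairMap₂ χ (comulHom χ x) = pushforward K (diag N) x.1 :=
  congrArg Subtype.val ((AlgEquiv.ofInjective (pairMap₂ χ) (pairMap₂_injective χ)).apply_symm_apply _)

theorem augmentation_mem (x : twistedGroupAlgebra K χ) :
    augmentation x.1 ∈ (Algebra.ofId K M).range := by
  refine (IsGalois.mem_range_algebraMap_iff_fixed _).2 fun σ => ?_
  have h1 : ∀ y : MonoidAlgebra M N, σ (augmentation y) = augmentation (galoisAction K χ σ y) :=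
      fun y => by
    induction y using MonoidAlgebra.induction_linear with
    | zero => simp
    | add x y hx hy => simp only [map_add, hx, hy]
    | single ν m => rw [galoisAction_single, augmentation_single, augmentation_single]
  rw [h1, mem_iff.1 x.2]

/-- The counit, the restriction of that of `M[N]`. -/
noncomputable def counitHom : twistedGroupAlgebra K χ →ₐ[K] K :=
  (AlgEquiv.ofInjective (Algebra.ofId K M) (algebraMap K M).injective).symm.toAlgHom.comp
    (((augmentation.restrictScalars K).comp (twistedGroupAlgebra K χ).val).codRestrict _
      (augmentation_mem χ))

theorem algebraMap_counitHom (x : twistedGroupAlgebra K χ) :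
    algebraMap K M (counitHom χ x) = augmentation x.1 :=
  congrArg Subtype.val ((AlgEquiv.ofInjective (Algebra.ofId K M)
    (algebraMap K M).injective).apply_symm_apply _)

theorem pushforward_one_eq {P : Type*} [CommGroup P] (x : twistedGroupAlgebra K χ) :
    pushforward K (1 : N →* P) x.1 = algebraMap K (MonoidAlgebra M P) (counitHom χ x) := by
  rw [pushforward_one, IsScalarTower.algebraMap_apply K M, algebraMap_counitHom]; rfl

/-- The antipode, the restriction of that of `M[N]`. -/
noncomputable def antipodeHom : twistedGroupAlgebra K χ →ₐ[K] twistedGroupAlgebra K χ :=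
  ((pushforward K (invMonoidHom : N →* N)).comp (twistedGroupAlgebra K χ).val).codRestrict _
    fun x => pushforward_mem (fun σ ν => by simp) x.2

/-- Since `pairMap₃` is injective, coassociativity reduces to an equality of homomorphisms `N → N ×
(N × N)`. -/
theorem pairMap₃_assoc (t : twistedGroupAlgebra K χ ⊗[K] twistedGroupAlgebra K χ)
    (y : twistedGroupAlgebra K χ) :
    pairMap₃ χ (Algebra.TensorProduct.assoc K K K _ _ _ (t ⊗ₜ y)) =
      pushforward K ((MonoidHom.id N).prodMap (MonoidHom.inl N N)) (pairMap₂ χ t) *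
        pushforward K ((MonoidHom.inr N (N × N)).comp (MonoidHom.inr N N)) y.1 := by
  induction t with
  | zero => simp
  | add a b ha hb => rw [TensorProduct.add_tmul, map_add, map_add, map_add, map_add, ha, hb, add_mul]
  | tmul a b =>
    rw [Algebra.TensorProduct.assoc_tmul, pairMap_tmul, pairMap_tmul, pairMap_tmul, map_mul, map_mul]
    simp only [pushforward_pushforward, mul_assoc]
    rfl

theorem coassoc_left (t : twistedGroupAlgebra K χ ⊗[K] twistedGroupAlgebra K χ) :
    pairMap₃ χ (Algebra.TensorProduct.assoc K K K _ _ _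
      (Algebra.TensorProduct.map (comulHom χ) (.id K _) t)) =
      pushforward K ((MonoidHom.fst N N).prod (MonoidHom.id _)) (pairMap₂ χ t) := by
  induction t with
  | zero => simp
  | add a b ha hb => simp only [map_add, ha, hb]
  | tmul a b =>
    rw [Algebra.TensorProduct.map_tmul, pairMap₃_assoc, pairMap₂_comulHom, pairMap_tmul, map_mul]
    simp only [pushforward_pushforward]
    rfl

theorem coassoc_right (t : twistedGroupAlgebra K χ ⊗[K] twistedGroupAlgebra K χ) :
    pairMap₃ χ (Algebra.TensorProduct.map (.id K _) (comulHom χ) t) =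
      pushforward K ((MonoidHom.id N).prodMap (diag N)) (pairMap₂ χ t) := by
  induction t with
  | zero => simp
  | add a b ha hb => simp only [map_add, ha, hb]
  | tmul a b =>
    rw [Algebra.TensorProduct.map_tmul, pairMap_tmul, pairMap₂_comulHom, pairMap_tmul, map_mul]
    simp only [pushforward_pushforward]
    rfl

theorem counit_left (t : twistedGroupAlgebra K χ ⊗[K] twistedGroupAlgebra K χ) :
    (Algebra.TensorProduct.lid K _ (Algebra.TensorProduct.map (counitHom χ) (.id K _) t)).1 =
      pushforward K (MonoidHom.snd N N) (pairMap₂ χ t) := by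
  induction t with
  | zero => simp
  | add a b ha hb => simp only [map_add, Subalgebra.coe_add, ha, hb]
  | tmul a b =>
    rw [Algebra.TensorProduct.map_tmul, Algebra.TensorProduct.lid_tmul, pairMap_tmul, map_mul,
      pushforward_pushforward, pushforward_pushforward, MonoidHom.snd_comp_inl,
      MonoidHom.snd_comp_inr, pushforward_one_eq, pushforward_id, ← Algebra.smul_def]
    rfl

theorem counit_right (t : twistedGroupAlgebra K χ ⊗[K] twistedGroupAlgebra K χ) :
    (Algebra.TensorProduct.rid K K _ (Algebra.TensorProduct.map (.id K _) (counitHom χ) t)).1 =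
      pushforward K (MonoidHom.fst N N) (pairMap₂ χ t) := by
  induction t with
  | zero => simp
  | add a b ha hb => simp only [map_add, Subalgebra.coe_add, ha, hb]
  | tmul a b =>
    rw [Algebra.TensorProduct.map_tmul, Algebra.TensorProduct.rid_tmul, pairMap_tmul, map_mul,
      pushforward_pushforward, pushforward_pushforward, MonoidHom.fst_comp_inl,
      MonoidHom.fst_comp_inr]
    change _ = pushforward K (MonoidHom.id N) a.1 * pushforward K 1 b.1
    rw [pushforward_one_eq, pushforward_id, mul_comm, ← Algebra.smul_def]
    rfl

theorem antipode_left (t : twistedGroupAlgebra K χ ⊗[K] twistedGroupAlgebra K χ) :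
    (LinearMap.mul' K _ ((antipodeHom χ).toLinearMap.rTensor _ t)).1 =
      pushforward K ((invMonoidHom : N →* N).coprod (MonoidHom.id N)) (pairMap₂ χ t) := by
  induction t with
  | zero => simp
  | add a b ha hb => simp only [map_add, Subalgebra.coe_add, ha, hb]
  | tmul a b =>
    rw [LinearMap.rTensor_tmul, LinearMap.mul'_apply, pairMap_tmul, map_mul,
      pushforward_pushforward, pushforward_pushforward, MonoidHom.coprod_comp_inl,
      MonoidHom.coprod_comp_inr, pushforward_id]
    rfl

theorem antipode_right (t : twistedGroupAlgebra K χ ⊗[K] twistedGroupAlgebra K χ) :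
    (LinearMap.mul' K _ ((antipodeHom χ).toLinearMap.lTensor _ t)).1 =
      pushforward K ((MonoidHom.id N).coprod (invMonoidHom : N →* N)) (pairMap₂ χ t) := by
  induction t with
  | zero => simp
  | add a b ha hb => simp only [map_add, Subalgebra.coe_add, ha, hb]
  | tmul a b =>
    rw [LinearMap.lTensor_tmul, LinearMap.mul'_apply, pairMap_tmul, map_mul,
      pushforward_pushforward, pushforward_pushforward, MonoidHom.coprod_comp_inl,
      MonoidHom.coprod_comp_inr, pushforward_id]
    rfl

noncomputable instance instBialgebra : Bialgebra K (twistedGroupAlgebra K χ) :=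
  Bialgebra.ofAlgHom (comulHom χ) (counitHom χ)
    (by
      refine AlgHom.ext fun x => pairMap₃_injective χ ?_
      refine (coassoc_left χ (comulHom χ x)).trans (.trans ?_ (coassoc_right χ (comulHom χ x)).symm)
      rw [pairMap₂_comulHom, pushforward_pushforward, pushforward_pushforward]
      rfl)
    (by
      refine AlgHom.ext fun x => (Algebra.TensorProduct.lid K _).injective (Subtype.ext ?_)
      refine (counit_left χ (comulHom χ x)).trans ?_
      rw [pairMap₂_comulHom, pushforward_pushforward, MonoidHom.snd_comp_prod, pushforward_id]
      simp)
    (by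
      refine AlgHom.ext fun x => (Algebra.TensorProduct.rid K K _).injective (Subtype.ext ?_)
      refine (counit_right χ (comulHom χ x)).trans ?_
      rw [pairMap₂_comulHom, pushforward_pushforward, MonoidHom.fst_comp_prod, pushforward_id]
      simp)

theorem comul_eq (x : twistedGroupAlgebra K χ) :
    Coalgebra.comul (R := K) x = comulHom χ x := rfl

theorem counit_eq (x : twistedGroupAlgebra K χ) :
    Coalgebra.counit (R := K) x = counitHom χ x := rfl

noncomputable instance instHopfAlgebra : HopfAlgebra K (twistedGroupAlgebra K χ) where
  antipode := (antipodeHom χ).toLinearMap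
  mul_antipode_rTensor_comul := by
    refine LinearMap.ext fun x => Subtype.ext ?_
    refine (antipode_left χ (comulHom χ x)).trans ?_
    rw [pairMap₂_comulHom, pushforward_pushforward]
    refine .trans ?_ (pushforward_one_eq χ x)
    congr 2
    ext ν; simp
  mul_antipode_lTensor_comul := by
    refine LinearMap.ext fun x => Subtype.ext ?_
    refine (antipode_right χ (comulHom χ x)).trans ?_
    rw [pairMap₂_comulHom, pushforward_pushforward]
    refine .trans ?_ (pushforward_one_eq χ x)
    congr 2
    ext ν; simp

instance : Coalgebra.IsCocomm K (twistedGroupAlgebra K χ) where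
  comm_comp_comul := by
    refine LinearMap.ext fun x => pairMap₂_injective χ ?_
    have h : ∀ t : twistedGroupAlgebra K χ ⊗[K] twistedGroupAlgebra K χ,
        pairMap₂ χ (TensorProduct.comm K _ _ t) =
          pushforward K ((MonoidHom.snd N N).prod (MonoidHom.fst N N)) (pairMap₂ χ t) := fun t => by
      induction t with
      | zero => simp
      | add a b ha hb => simp only [map_add, ha, hb]
      | tmul a b =>
        rw [TensorProduct.comm_tmul, pairMap_tmul, pairMap_tmul, map_mul, pushforward_pushforward,
          pushforward_pushforward, mul_comm]
        rfl
    refine (h (comulHom χ x)).trans ?_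
    change _ = pairMap₂ χ (comulHom χ x)
    rw [pairMap₂_comulHom, pushforward_pushforward]
    rfl

end Hopf
end TwistedGroupAlgebra

namespace TwistedGroupAlgebra

variable {K M N : Type*} [Field K] [Field M] [Algebra K M] [FiniteDimensional K M]
  [CommGroup N] (χ : (M ≃ₐ[K] M) →* MulAut N) [IsGalois K M]

/-! ### Base change to the group algebra -/

section BaseChange

variable (M' : Type*) [Field M'] [Algebra K M'] [Algebra M M'] [IsScalarTower K M M']

/-- Extension of coefficients `M[N] → M'[N]`. -/
noncomputable abbrev extendCoeff (K : Type*) {M : Type*} (M' : Type*) (N : Type*) [Field K] [Field M]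
    [Algebra K M] [CommGroup N] [Field M'] [Algebra K M'] [Algebra M M'] [IsScalarTower K M M'] :
    MonoidAlgebra M N →ₐ[K] MonoidAlgebra M' N :=
  MonoidAlgebra.mapAlgHom N (IsScalarTower.toAlgHom K M M')

theorem extendCoeff_single (ν : N) (m : M) :
    extendCoeff K M' N (MonoidAlgebra.single ν m) = MonoidAlgebra.single ν (algebraMap M M' m) := by
  rw [MonoidAlgebra.mapAlgHom_single]; rfl

/-- The map `M' ⊗ H → M'[N]`. -/
noncomputable def baseChangeHom :
    M' ⊗[K] twistedGroupAlgebra K χ →ₐ[M'] MonoidAlgebra M' N :=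
  Algebra.TensorProduct.lift (Algebra.ofId M' _)
    ((extendCoeff K M' N).comp (twistedGroupAlgebra K χ).val) fun _ _ => Commute.all _ _

theorem baseChangeHom_tmul (m : M') (x : twistedGroupAlgebra K χ) :
    baseChangeHom χ M' (m ⊗ₜ x) = algebraMap M' (MonoidAlgebra M' N) m * extendCoeff K M' N x.1 :=
  rfl

theorem baseChangeHom_one_tmul (x : twistedGroupAlgebra K χ) :
    baseChangeHom χ M' (1 ⊗ₜ x) = extendCoeff K M' N x.1 := by
  rw [baseChangeHom_tmul, map_one, one_mul]

/-- The map `M'[N × N] → M'[N] ⊗ M'[N]`. -/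
noncomputable def splitProd (M' N : Type*) [Field M'] [CommGroup N] : MonoidAlgebra M' (N × N) →ₐ[M']
    MonoidAlgebra M' N ⊗[M'] MonoidAlgebra M' N :=
  MonoidAlgebra.lift M' _ (N × N)
    { toFun := fun p => MonoidAlgebra.single p.1 1 ⊗ₜ MonoidAlgebra.single p.2 1
      map_one' := rfl
      map_mul' := fun p q => by
        rw [Algebra.TensorProduct.tmul_mul_tmul, MonoidAlgebra.single_mul_single,
          MonoidAlgebra.single_mul_single, mul_one]; rfl }

theorem splitProd_single (ν μ : N) (m : M') : splitProd M' N (MonoidAlgebra.single (ν, μ) m) =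
    m • (MonoidAlgebra.single ν 1 ⊗ₜ MonoidAlgebra.single μ 1) := by
  simp [splitProd]

theorem splitProd_inl (x : MonoidAlgebra M N) :
    splitProd M' N (extendCoeff K M' (N × N) (pushforward K (MonoidHom.inl N N) x)) =
      extendCoeff K M' N x ⊗ₜ 1 := by
  induction x using MonoidAlgebra.induction_linear with
  | zero => simp
  | add x y hx hy => simp only [map_add, TensorProduct.add_tmul, hx, hy]
  | single ν m =>
    rw [pushforward_single, extendCoeff_single, extendCoeff_single, MonoidHom.inl_apply,
      splitProd_single, TensorProduct.smul_tmul', MonoidAlgebra.smul_single', mul_one]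
    rfl

theorem splitProd_inr (x : MonoidAlgebra M N) :
    splitProd M' N (extendCoeff K M' (N × N) (pushforward K (MonoidHom.inr N N) x)) =
      1 ⊗ₜ extendCoeff K M' N x := by
  induction x using MonoidAlgebra.induction_linear with
  | zero => simp
  | add x y hx hy => simp only [map_add, TensorProduct.tmul_add, hx, hy]
  | single ν m =>
    rw [pushforward_single, extendCoeff_single, extendCoeff_single, MonoidHom.inr_apply,
      splitProd_single, ← TensorProduct.tmul_smul, MonoidAlgebra.smul_single', mul_one]
    rfl

theorem splitProd_diag (x : MonoidAlgebra M N) :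
    splitProd M' N (extendCoeff K M' (N × N) (pushforward K (diag N) x)) =
      Coalgebra.comul (R := M') (extendCoeff K M' N x) := by
  induction x using MonoidAlgebra.induction_linear with
  | zero => simp
  | add x y hx hy => simp only [map_add, hx, hy]
  | single ν m =>
    rw [pushforward_single, extendCoeff_single, extendCoeff_single, MonoidHom.prod_apply,
      MonoidHom.id_apply, splitProd_single, MonoidAlgebra.comul_single, CommSemiring.comul_apply,
      TensorProduct.map_tmul, ← TensorProduct.tmul_smul]
    simp [Algebra.smul_def]

theorem counit_extendCoeff (x : MonoidAlgebra M N) :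
    Coalgebra.counit (R := M') (extendCoeff K M' N x) = algebraMap M M' (augmentation x) := by
  induction x using MonoidAlgebra.induction_linear with
  | zero => simp
  | add x y hx hy => simp only [map_add, hx, hy]
  | single ν m => rw [extendCoeff_single, augmentation_single]; simp

/-- Isolates the shuffle of tensor factors in the coproduct of `M' ⊗ A`; as `G` is additive, pure
tensors suffice. -/
theorem map_tensorTensorTensorComm {K M' A B : Type*} [Field K] [Field M'] [Algebra K M'] [CommRing A]
    [Algebra K A] [CommRing B] [Algebra M' B] (F : M' ⊗[K] A →ₐ[M'] B) (G : A ⊗[K] A →+ B ⊗[M'] B)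
    (hG : ∀ a b, G (a ⊗ₜ b) = F (1 ⊗ₜ a) ⊗ₜ F (1 ⊗ₜ b)) (t : A ⊗[K] A) :
    Algebra.TensorProduct.map F F (TensorProduct.AlgebraTensorModule.tensorTensorTensorComm
      K M' K M' M' M' A A (Coalgebra.comul (R := M') (1 : M') ⊗ₜ t)) = G t := by
  induction t with
  | zero => simp
  | add a b ha hb => simp only [map_add, TensorProduct.tmul_add, ha, hb]
  | tmul a b =>
    rw [CommSemiring.comul_apply, TensorProduct.AlgebraTensorModule.tensorTensorTensorComm_tmul,
      Algebra.TensorProduct.map_tmul, hG]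

variable [Finite N]

/-- The bialgebra homomorphism `M' ⊗ H → M'[N]`. -/
noncomputable def baseChangeBialgHom :
    M' ⊗[K] twistedGroupAlgebra K χ →ₐc[M'] MonoidAlgebra M' N :=
  BialgHom.ofAlgHom (baseChangeHom χ M')
    (by
      refine Algebra.TensorProduct.ext (Subsingleton.elim _ _) (AlgHom.ext fun x => ?_)
      change Coalgebra.counit (R := M') (baseChangeHom χ M' (1 ⊗ₜ x)) =
        Coalgebra.counit (R := M') ((1 : M') ⊗ₜ[K] x)
      rw [baseChangeHom_one_tmul, counit_extendCoeff, TensorProduct.counit_tmul, counit_eq,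
        ← algebraMap_counitHom, ← IsScalarTower.algebraMap_apply, Algebra.smul_def]
      simp)
    (by
      refine Algebra.TensorProduct.ext (Subsingleton.elim _ _) (AlgHom.ext fun x => ?_)
      change Algebra.TensorProduct.map (baseChangeHom χ M') (baseChangeHom χ M')
          (Coalgebra.comul (R := M') ((1 : M') ⊗ₜ[K] x)) =
        Coalgebra.comul (R := M') (baseChangeHom χ M' (1 ⊗ₜ x))
      rw [baseChangeHom_one_tmul, ← splitProd_diag, ← pairMap₂_comulHom, TensorProduct.comul_tmul,
        comul_eq]
      refine map_tensorTensorTensorComm (baseChangeHom χ M')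
        (((splitProd M' N).toRingHom.comp (extendCoeff K M' (N × N)).toRingHom).comp
          (pairMap₂ χ).toRingHom).toAddMonoidHom (fun a b => ?_) (comulHom χ x)
      change splitProd M' N (extendCoeff K M' (N × N) (pairMap₂ χ (a ⊗ₜ b))) = _
      rw [baseChangeHom_one_tmul, baseChangeHom_one_tmul, pairMap_tmul, map_mul, map_mul,
        splitProd_inl, Subalgebra.val_apply, splitProd_inr, Algebra.TensorProduct.tmul_mul_tmul,
        mul_one, one_mul])

/-- The invariants span `M[N]` over `M`, and the group elements span `M'[N]` over `M'`. -/
theorem baseChangeHom_surjective : Function.Surjective (baseChangeHom χ M') := by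
  have h1 : ∀ x : MonoidAlgebra M N, extendCoeff K M' N x ∈ (baseChangeHom χ M').range := fun x => by
    have hx : x ∈ Submodule.span M (twistedGroupAlgebra K χ : Set (MonoidAlgebra M N)) := by
      rw [span_eq_top]; trivial
    induction hx using Submodule.span_induction with
    | mem x hx => exact ⟨1 ⊗ₜ ⟨x, hx⟩, baseChangeHom_one_tmul χ M' ⟨x, hx⟩⟩
    | zero => rw [map_zero]; exact Subalgebra.zero_mem _
    | add x y _ _ hx hy => rw [map_add]; exact Subalgebra.add_mem _ hx hy
    | smul m x _ hx =>
      have : extendCoeff K M' N (m • x) = algebraMap M M' m • extendCoeff K M' N x := by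
        ext ν; simp [Algebra.smul_def]
      rw [this]
      exact Subalgebra.smul_mem _ hx _
  intro y
  change y ∈ (baseChangeHom χ M').range
  induction y using MonoidAlgebra.induction_linear with
  | zero => exact Subalgebra.zero_mem _
  | add x y hx hy => exact Subalgebra.add_mem _ hx hy
  | single ν m =>
    have := Subalgebra.smul_mem _ (h1 (MonoidAlgebra.single ν 1)) m
    rwa [extendCoeff_single, map_one, MonoidAlgebra.smul_single', mul_one] at this

/-- The twisted group algebra is a form of the group algebra. -/
noncomputable def baseChangeBialgEquiv :
    (M' ⊗[K] twistedGroupAlgebra K χ) ≃ₐc[M'] MonoidAlgebra M' N :=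
  BialgEquiv.ofBijective (baseChangeBialgHom χ M') (by
    have hs := baseChangeHom_surjective χ M'
    have : Module.Finite M' (MonoidAlgebra M' N) := Module.Finite.of_basis (MonoidAlgebra.basis N M')
    refine ⟨?_, hs⟩
    refine (@LinearMap.injective_iff_surjective_of_finrank_eq_finrank M'
      (M' ⊗[K] twistedGroupAlgebra K χ) _ _ _ (MonoidAlgebra M' N) _ _ inferInstance inferInstance ?_
      (baseChangeHom χ M').toLinearMap).2 hs
    rw [Module.finrank_baseChange, finrank_eq,
      Module.finrank_eq_nat_card_basis (MonoidAlgebra.basis N M')])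

end BaseChange

/-! ### The action of the twisted group algebra on `L` -/

section Action

variable {L : Type*} [Field L] [Algebra K L] (β : N →* Equiv.Perm (L →ₐ[K] M))

/-- The sum `∑ y_ν * (β ν x) l`. -/
noncomputable def evalSum (x : L →ₐ[K] M) (l : L) : MonoidAlgebra M N →ₗ[M] M :=
  Finsupp.linearCombination M (fun ν => β ν x l) ∘ₗ (MonoidAlgebra.coeffLinearEquiv M).toLinearMap

theorem evalSum_single (x : L →ₐ[K] M) (l : L) (ν : N) (m : M) :
    evalSum β x l (MonoidAlgebra.single ν m) = m * β ν x l := by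
  simp [evalSum]

theorem map_evalSum (hβ : ∀ (σ : M ≃ₐ[K] M) ν x,
      (σ : M →ₐ[K] M).comp (β ν x) = β (χ σ ν) ((σ : M →ₐ[K] M).comp x))
    (σ : M ≃ₐ[K] M) (x : L →ₐ[K] M) (l : L) (y : MonoidAlgebra M N) :
    σ (evalSum β x l y) = evalSum β ((σ : M →ₐ[K] M).comp x) l (galoisAction K χ σ y) := by
  induction y using MonoidAlgebra.induction_linear with
  | zero => simp
  | add y z hy hz => simp only [map_add, hy, hz]
  | single ν m =>
    rw [galoisAction_single, evalSum_single, evalSum_single, ← hβ, map_mul]; rfl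

theorem evalSum_one (x : L →ₐ[K] M) (y : MonoidAlgebra M N) :
    evalSum β x 1 y = augmentation y := by
  induction y using MonoidAlgebra.induction_linear with
  | zero => simp
  | add y z hy hz => simp only [map_add, hy, hz]
  | single ν m => rw [evalSum_single, augmentation_single, map_one, mul_one]

theorem evalSum_single_mul (x : L →ₐ[K] M) (l : L) (ν : N) (m : M) (y : MonoidAlgebra M N) :
    evalSum β x l (MonoidAlgebra.single ν m * y) = m * evalSum β (β ν x) l y := by
  induction y using MonoidAlgebra.induction_linear with
  | zero => simp
  | add y z hy hz => simp only [map_add, mul_add, hy, hz]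
  | single μ m' =>
    rw [MonoidAlgebra.single_mul_single, evalSum_single, evalSum_single, mul_comm ν μ, map_mul,
      Equiv.Perm.mul_apply, mul_assoc]

theorem evalSum_eq_sum [Fintype N] (x : L →ₐ[K] M) (l : L) (y : MonoidAlgebra M N) :
    evalSum β x l y = ∑ ν, y.coeff ν * β ν x l := by
  rw [evalSum, LinearMap.comp_apply, Finsupp.linearCombination_apply, Finsupp.sum_fintype _ _ (by simp)]
  rfl

/-- The sum `∑ y_{ν, μ} * (β ν x) l * (β μ x) l'`. -/
noncomputable def evalSum₂ (x : L →ₐ[K] M) (l l' : L) : MonoidAlgebra M (N × N) →ₗ[M] M :=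
  Finsupp.linearCombination M (fun p : N × N => β p.1 x l * β p.2 x l') ∘ₗ
    (MonoidAlgebra.coeffLinearEquiv M).toLinearMap

theorem evalSum₂_single (x : L →ₐ[K] M) (l l' : L) (ν μ : N) (m : M) :
    evalSum₂ β x l l' (MonoidAlgebra.single (ν, μ) m) = m * (β ν x l * β μ x l') := by
  simp [evalSum₂]

theorem evalSum₂_diag (x : L →ₐ[K] M) (l l' : L) (y : MonoidAlgebra M N) :
    evalSum₂ β x l l' (pushforward K (diag N) y) = evalSum β x (l * l') y := by
  induction y using MonoidAlgebra.induction_linear with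
  | zero => simp
  | add y z hy hz => simp only [map_add, hy, hz]
  | single ν m =>
    rw [pushforward_single, MonoidHom.prod_apply, MonoidHom.id_apply, evalSum₂_single,
      evalSum_single, map_mul]

theorem evalSum₂_mul (x : L →ₐ[K] M) (l l' : L) (y z : MonoidAlgebra M N) :
    evalSum₂ β x l l' (pushforward K (MonoidHom.inl N N) y * pushforward K (MonoidHom.inr N N) z) =
      evalSum β x l y * evalSum β x l' z := by
  induction y using MonoidAlgebra.induction_linear with
  | zero => simp
  | add y₁ y₂ h₁ h₂ => simp only [map_add, add_mul, h₁, h₂]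
  | single ν m =>
    induction z using MonoidAlgebra.induction_linear with
    | zero => simp
    | add z₁ z₂ h₁ h₂ => simp only [map_add, mul_add, h₁, h₂]
    | single μ m' =>
      rw [pushforward_single, pushforward_single, MonoidAlgebra.single_mul_single,
        MonoidHom.inl_apply, MonoidHom.inr_apply, Prod.mk_mul_mk, mul_one, one_mul,
        evalSum₂_single, evalSum_single, evalSum_single]
      ring

theorem mem_range_of_fixed (x : L →ₐ[K] M) {m : M}
    (hm : ∀ σ : M ≃ₐ[K] M, (σ : M →ₐ[K] M).comp x = x → σ m = m) : ∃ l, x l = m := by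
  have : m ∈ IntermediateField.fixedField (IntermediateField.fixingSubgroup x.fieldRange) := by
    rintro ⟨σ, hσ⟩
    exact hm σ (AlgHom.ext fun l => hσ ⟨x l, ⟨l, rfl⟩⟩)
  rwa [IsGalois.fixedField_fixingSubgroup] at this

/-- For invariant `h`, the sum `∑ h_ν * (β ν x) l` varies equivariantly with `x`. It is fixed by the
stabilizer of `x`, hence lies in `x(L)`, and transitivity makes its preimage in `L` independent of
`x`. -/
theorem exists_action [Nonempty (L →ₐ[K] M)] (hβ : ∀ (σ : M ≃ₐ[K] M) ν x,
      (σ : M →ₐ[K] M).comp (β ν x) = β (χ σ ν) ((σ : M →ₐ[K] M).comp x))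
    (htrans : ∀ x y : L →ₐ[K] M, ∃ σ : M ≃ₐ[K] M, (σ : M →ₐ[K] M).comp x = y) :
    ∃ act : twistedGroupAlgebra K χ →ₐ[K] Module.End K L,
      ∀ h l (x : L →ₐ[K] M), x (act h l) = evalSum β x l h.1 := by
  have h1 : ∀ (h : twistedGroupAlgebra K χ) (l : L), ∃ l', ∀ x : L →ₐ[K] M,
      x l' = evalSum β x l h.1 := fun h l => by
    let x₀ : L →ₐ[K] M := Classical.arbitrary _
    obtain ⟨l', hl'⟩ := mem_range_of_fixed x₀ (m := evalSum β x₀ l h.1) fun σ hσ => by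
      rw [map_evalSum χ β hβ, hσ, mem_iff.1 h.2]
    refine ⟨l', fun x => ?_⟩
    obtain ⟨σ, rfl⟩ := htrans x₀ x
    rw [← mem_iff.1 h.2 σ, ← map_evalSum χ β hβ, ← hl']; rfl
  choose act hact using h1
  let x₀ : L →ₐ[K] M := Classical.arbitrary _
  have hx₀ : Function.Injective x₀ := x₀.injective
  have hsm : ∀ (c : K) (m : M), c • m = algebraMap K M c * m := fun c m => Algebra.smul_def c m
  have hladd : ∀ (x : L →ₐ[K] M) (l l' : L) (y : MonoidAlgebra M N),
      evalSum β x (l + l') y = evalSum β x l y + evalSum β x l' y := fun x l l' y => by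
    induction y using MonoidAlgebra.induction_linear with
    | zero => simp
    | add y z hy hz => rw [map_add, map_add, map_add, hy, hz]; ring
    | single ν m => rw [evalSum_single, evalSum_single, evalSum_single, map_add, mul_add]
  have hlsmul : ∀ (x : L →ₐ[K] M) (c : K) (l : L) (y : MonoidAlgebra M N),
      evalSum β x (c • l) y = c • evalSum β x l y := fun x c l y => by
    induction y using MonoidAlgebra.induction_linear with
    | zero => simp
    | add y z hy hz => rw [map_add, map_add, hy, hz, smul_add]
    | single ν m => rw [evalSum_single, evalSum_single, map_smul, mul_smul_comm]
  let actL : twistedGroupAlgebra K χ →ₗ[K] Module.End K L :=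
    LinearMap.mk₂ K act
      (fun h h' l => hx₀ (by rw [map_add, hact, hact, hact, ← map_add]; rfl))
      (fun c h l => hx₀ (by
        rw [map_smul, hact, hact, hsm, IsScalarTower.algebraMap_apply K M M, Algebra.algebraMap_self,
          RingHom.id_apply, ← smul_eq_mul, ← map_smul, algebraMap_smul]; rfl))
      (fun h l l' => hx₀ (by rw [map_add, hact, hact, hact, hladd]))
      (fun c h l => hx₀ (by rw [map_smul, hact, hact, hlsmul]))
  have hactL : ∀ h l (x : L →ₐ[K] M), x (actL h l) = evalSum β x l h.1 := fun h l x => hact h l x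
  refine ⟨AlgHom.ofLinearMap actL ?_ ?_, hactL⟩
  · ext l
    refine hx₀ ?_
    rw [hactL]
    change evalSum β x₀ l (MonoidAlgebra.single 1 1) = _
    rw [evalSum_single, map_one]; simp
  · intro h h'
    ext l
    refine hx₀ ?_
    rw [Module.End.mul_apply, hactL, hactL]
    change evalSum β x₀ l (h.1 * h'.1) = _
    induction h.1 using MonoidAlgebra.induction_linear with
    | zero => simp
    | add y z hy hz => rw [add_mul, map_add, map_add, hy, hz]
    | single ν m => rw [evalSum_single_mul, evalSum_single, hactL]

/-- The coefficients of `t ∈ L ⊗ H`, with `L` embedded in `M` by `x`. -/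
noncomputable def embedCoeff (x : L →ₐ[K] M) :
    L ⊗[K] twistedGroupAlgebra K χ →ₗ[K] (N → M) :=
  TensorProduct.lift (LinearMap.mk₂ K (fun l h ν => x l * h.1.coeff ν)
    (fun l l' h => by ext; simp [add_mul]) (fun c l h => by ext; simp)
    (fun l h h' => by ext; simp [mul_add]) (fun c l h => by ext; simp))

theorem embedCoeff_tmul (x : L →ₐ[K] M) (l : L) (h : twistedGroupAlgebra K χ) (ν : N) :
    embedCoeff χ x (l ⊗ₜ h) ν = x l * h.1.coeff ν := rfl

theorem embedCoeff_injective (x : L →ₐ[K] M) : Function.Injective (embedCoeff χ x) := by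
  let b := Module.Free.chooseBasis K (twistedGroupAlgebra K χ)
  let dup : (N → M) →ₗ[K] (N × Unit → M) := LinearMap.funLeft K M Prod.fst
  have h := injective_of_apply_tmul b (linearIndependent_coeffMap χ b.linearIndependent)
    (g := LinearMap.pi (fun _ : Unit => x.toLinearMap)) (fun l l' hl => x.injective (congrFun hl ()))
    (dup ∘ₗ embedCoeff χ x ∘ₗ (TensorProduct.comm K _ _).toLinearMap) fun h l ν _ => mul_comm _ _
  intro t t' htt
  refine (TensorProduct.comm K _ _).symm.injective (h ?_)
  simp [htt]

theorem exists_hopfGaloisStructure [Finite N] [FiniteDimensional K L] [Nonempty (L →ₐ[K] M)]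
    (hβ : ∀ (σ : M ≃ₐ[K] M) ν x,
      (σ : M →ₐ[K] M).comp (β ν x) = β (χ σ ν) ((σ : M →ₐ[K] M).comp x))
    (htrans : ∀ x y : L →ₐ[K] M, ∃ σ : M ≃ₐ[K] M, (σ : M →ₐ[K] M).comp x = y)
    (hinj : ∀ x, Function.Injective fun ν => β ν x) (hcard : Nat.card N = Module.finrank K L) :
    Nonempty (HopfGaloisStructure K L (twistedGroupAlgebra K χ)) := by
  obtain ⟨act, hact⟩ := exists_action χ β hβ htrans
  let x₀ : L →ₐ[K] M := Classical.arbitrary _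
  have hx₀ : Function.Injective x₀ := x₀.injective
  refine ⟨⟨inferInstance, inferInstance, act, fun h => hx₀ ?_, fun h l l' => hx₀ ?_, ?_⟩⟩
  · rw [hact, evalSum_one, ← algebraMap_counitHom, AlgHom.commutes]; rfl
  · rw [hact, ← evalSum₂_diag, ← pairMap₂_comulHom, comul_eq]
    generalize comulHom χ h = t
    induction t with
    | zero => simp
    | add a b ha hb => simp only [map_add, LinearMap.add_apply, ha, hb]
    | tmul a b =>
      rw [pairMap_tmul, Subalgebra.val_apply, evalSum₂_mul, ← hact, ← hact]
      simp
  · have := Fintype.ofFinite N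
    let Γ : L ⊗[K] twistedGroupAlgebra K χ →ₗ[K] Module.End K L :=
      LinearMap.mul' K (Module.End K L) ∘ₗ
        TensorProduct.map (Algebra.lmul K L).toLinearMap act.toLinearMap
    have hΓ : ∀ t l, x₀ (Γ t l) = ∑ ν, embedCoeff χ x₀ t ν * β ν x₀ l := fun t l => by
      induction t with
      | zero => simp
      | add a b ha hb =>
        simp only [map_add, LinearMap.add_apply, ha, hb, Pi.add_apply, add_mul,
          Finset.sum_add_distrib]
      | tmul l' h =>
        have : Γ (l' ⊗ₜ h) l = l' * act h l := rfl
        rw [this, map_mul, hact, evalSum_eq_sum, Finset.mul_sum]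
        simp only [embedCoeff_tmul, mul_assoc]
    have hinjΓ : Function.Injective Γ := by
      rw [injective_iff_map_eq_zero]
      intro t ht
      refine embedCoeff_injective χ x₀ (.trans ?_ (map_zero _).symm)
      -- Dedekind independence of the distinct embeddings `β ν x₀` forces all coefficients of `t` to
      -- vanish; surjectivity then follows by dimension.
      have hli := (linearIndependent_toLinearMap K L M).comp (fun ν => β ν x₀) (hinj x₀)
      funext ν
      refine Fintype.linearIndependent_iff.1 hli (embedCoeff χ x₀ t) (LinearMap.ext fun l => ?_) ν
      have := hΓ t l
      rw [ht, LinearMap.zero_apply, map_zero] at this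
      simpa [LinearMap.sum_apply] using this.symm
    refine ⟨hinjΓ, ?_⟩
    refine (@LinearMap.injective_iff_surjective_of_finrank_eq_finrank K
      (L ⊗[K] twistedGroupAlgebra K χ) _ _ _ (Module.End K L) _ _ inferInstance inferInstance ?_
      Γ).1 hinjΓ
    rw [Module.finrank_tensorProduct, finrank_eq, Module.finrank_linearMap, hcard]

end Action
end TwistedGroupAlgebra

/-! ### Affine structures on the set of embeddings -/

theorem AlgHom.exists_algEquiv_comp_eq {K L M : Type*} [Field K] [Field L] [Field M] [Algebra K L]
    [Algebra K M] [Normal K M] (x y : L →ₐ[K] M) :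
    ∃ σ : M ≃ₐ[K] M, (σ : M →ₐ[K] M).comp x = y := by
  let χ : x.fieldRange ≃ₐ[K] y.fieldRange :=
    (AlgEquiv.ofInjectiveField x).symm.trans (AlgEquiv.ofInjectiveField y)
  refine ⟨χ.liftNormal M, AlgHom.ext fun l => ?_⟩
  have h := χ.liftNormal_commutes M (AlgEquiv.ofInjectiveField x l)
  have h1 : χ (AlgEquiv.ofInjectiveField x l) = AlgEquiv.ofInjectiveField y l := by
    change (AlgEquiv.ofInjectiveField y) ((AlgEquiv.ofInjectiveField x).symm _) = _
    rw [AlgEquiv.symm_apply_apply]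
  rw [h1] at h
  exact h

/-- A labelling of the `K`-embeddings of `L` in `E` by `ZMod n` for which `Gal(E/K)` acts by affine
maps. -/
def IsAffineLabelling {K L E : Type*} [Field K] [Field L] [Field E] [Algebra K L] [Algebra K E]
    {n : ℕ} (f : (L →ₐ[K] E) ≃ ZMod n) : Prop :=
  ∀ σ : E ≃ₐ[K] E, ∃ a b, ∀ x, f ((σ : E →ₐ[K] E).comp x) = a * f x + b

namespace IsAffineLabelling

variable {K L E : Type*} [Field K] [Field L] [Field E] [Algebra K L] [Algebra K E] {n : ℕ}
  {f : (L →ₐ[K] E) ≃ ZMod n} (hf : IsAffineLabelling f)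

/-- The permutation action of the Galois group on labels. -/
def labelPerm (f : (L →ₐ[K] E) ≃ ZMod n) : (E ≃ₐ[K] E) →* Equiv.Perm (ZMod n) :=
  MonoidHom.toHomPerm
    { toFun := fun σ y => f ((σ : E →ₐ[K] E).comp (f.symm y))
      map_one' := by
        funext y
        refine (congrArg f ?_).trans (f.apply_symm_apply y)
        ext; rfl
      map_mul' := fun σ τ => by
        funext y
        change _ = f ((σ : E →ₐ[K] E).comp (f.symm (f _)))
        rw [f.symm_apply_apply]
        rfl }

theorem labelPerm_apply (σ : E ≃ₐ[K] E) (y : ZMod n) :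
    labelPerm f σ y = f ((σ : E →ₐ[K] E).comp (f.symm y)) := rfl

/-- The affine action of the Galois group attached to an affine labelling. -/
def toAffineAction : AffineAction (E ≃ₐ[K] E) n :=
  .ofPerm (labelPerm f) fun σ => by
    obtain ⟨a, b, h⟩ := hf σ
    exact ⟨a, b, fun y => by rw [labelPerm_apply, h, f.apply_symm_apply]⟩

theorem toAffineAction_b (σ : E ≃ₐ[K] E) :
    hf.toAffineAction.b σ = f ((σ : E →ₐ[K] E).comp (f.symm 0)) := rfl

theorem apply_comp (σ : E ≃ₐ[K] E) (x : L →ₐ[K] E) :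
    f ((σ : E →ₐ[K] E).comp x) = hf.toAffineAction.a σ * f x + hf.toAffineAction.b σ := by
  obtain ⟨a, b, h⟩ := hf σ
  have hb : hf.toAffineAction.b σ = b := by
    rw [toAffineAction_b, h, f.apply_symm_apply, mul_zero, zero_add]
  have ha : hf.toAffineAction.a σ = a := by
    change labelPerm f σ 1 - labelPerm f σ 0 = a
    rw [labelPerm_apply, labelPerm_apply, h, h, f.apply_symm_apply, f.apply_symm_apply]
    ring
  rw [h, ha, hb]

theorem toAffineAction_transitive [Normal K E] : hf.toAffineAction.Transitive := fun y => by
  obtain ⟨σ, hσ⟩ := AlgHom.exists_algEquiv_comp_eq (f.symm 0) (f.symm y)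
  exact ⟨σ, by rw [toAffineAction_b, hσ, f.apply_symm_apply]⟩

/-- An automorphism fixing every label fixes the image of every embedding, and these images generate
the normal closure. -/
theorem toAffineAction_faithful [Algebra.IsAlgebraic K L] [IsNormalClosure K L E] :
    hf.toAffineAction.Faithful := fun σ ha hb => by
  have h1 : ∀ x : L →ₐ[K] E, (σ : E →ₐ[K] E).comp x = x := fun x => f.injective <| by
    rw [hf.apply_comp, ha, hb, one_mul, add_zero]
  have h2 : IntermediateField.normalClosure K L E ≤
      IntermediateField.fixedField (Subgroup.zpowers σ) := by
    refine normalClosure_le_iff.2 fun x => ?_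
    rw [IntermediateField.le_iff_le, Subgroup.zpowers_le, IntermediateField.mem_fixingSubgroup_iff]
    rintro _ ⟨l, rfl⟩
    exact DFunLike.congr_fun (h1 x) l
  rw [(Algebra.IsAlgebraic.isNormalClosure_iff.1 ‹IsNormalClosure K L E›).2,
    IntermediateField.le_iff_le, Subgroup.zpowers_le, IntermediateField.mem_fixingSubgroup_iff] at h2
  exact AlgEquiv.ext fun t => h2 t trivial

end IsAffineLabelling

/-- Over an affine action whose point stabilizer is the group fixing `L'`, the embeddings of `L'`
have an affine labelling. -/
theorem AffineAction.exists_isAffineLabelling {K E : Type*} [Field K] [Field E] [Algebra K E]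
    [Normal K E] {n : ℕ} (A : AffineAction (E ≃ₐ[K] E) n) (hA : A.Transitive)
    (L' : IntermediateField K E) (hL' : L'.fixingSubgroup = A.stabilizer) :
    ∃ f : (L' →ₐ[K] E) ≃ ZMod n, IsAffineLabelling f := by
  -- An embedding is labelled by the image of `0` under any automorphism extending it; the choice is
  -- immaterial because the stabilizer of `0` is exactly the group fixing `L'`.
  choose s hs using fun x : L' →ₐ[K] E => AlgHom.exists_algEquiv_comp_eq L'.val x
  have key : ∀ σ τ : E ≃ₐ[K] E, A.b σ = A.b τ ↔
      (σ : E →ₐ[K] E).comp L'.val = (τ : E →ₐ[K] E).comp L'.val := fun σ τ => by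
    rw [A.b_eq_iff, ← hL', IntermediateField.mem_fixingSubgroup_iff]
    refine ⟨fun h => AlgHom.ext fun l => ?_, fun h l hl => ?_⟩
    · have := congrArg σ (h l l.2)
      rw [AlgEquiv.mul_apply, ← AlgEquiv.mul_apply σ σ⁻¹, mul_inv_cancel] at this
      exact this.symm
    · rw [AlgEquiv.mul_apply]
      have := DFunLike.congr_fun h ⟨l, hl⟩
      change σ l = τ l at this
      rw [← this, ← AlgEquiv.mul_apply, inv_mul_cancel, AlgEquiv.one_apply]
  refine ⟨.ofBijective (fun x => A.b (s x)) ⟨fun x y h => ?_, fun y => ?_⟩, fun σ => ?_⟩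
  · rw [← hs x, ← hs y]; exact (key _ _).1 h
  · obtain ⟨τ, rfl⟩ := hA y
    exact ⟨(τ : E →ₐ[K] E).comp L'.val, (key _ _).2 (hs _)⟩
  · refine ⟨A.a σ, A.b σ, fun x => ?_⟩
    change A.b (s _) = A.a σ * A.b (s x) + A.b σ
    rw [← A.b_mul, key, hs]
    conv_lhs => rw [← hs x]
    rfl

/-! ### Normal closures of separable extensions -/

namespace IsNormalClosure

variable (K L E : Type*) [Field K] [Field L] [Field E] [Algebra K L] [Algebra K E]
  [h : IsNormalClosure K L E]

theorem normalClosure_eq_top [Algebra.IsAlgebraic K L] :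
    IntermediateField.normalClosure K L E = ⊤ :=
  (Algebra.IsAlgebraic.isNormalClosure_iff.1 h).2

theorem finiteDimensional [FiniteDimensional K L] : FiniteDimensional K E := by
  have := normalClosure.is_finiteDimensional K L E
  rw [normalClosure_eq_top] at this
  exact IntermediateField.topEquiv.toLinearEquiv.finiteDimensional

theorem isGalois [Algebra.IsSeparable K L] : IsGalois K E := by
  have hn : Normal K E := h.normal
  have h1 : IntermediateField.normalClosure K L E ≤ separableClosure K E :=
    normalClosure_le_iff.2 fun x => by
      rw [le_separableClosure_iff]
      exact AlgEquiv.Algebra.isSeparable (AlgEquiv.ofInjectiveField x)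
  rw [normalClosure_eq_top, top_le_iff, separableClosure.eq_top_iff] at h1
  exact ⟨⟩

end IsNormalClosure

/-! ### Labellings and Hopf-Galois structures of cyclic type -/

section Criterion

variable {K : Type u} {L : Type v} {E : Type w} [Field K] [Field L] [Field E] [Algebra K L]
  [Algebra K E] [FiniteDimensional K L] [Algebra.IsSeparable K L]

theorem AdmitsCyclicHopfGaloisStructure.exists_isAffineLabelling {n : ℕ}
    (hn : Module.finrank K L = n)
    (hsplits : ∀ l : L, ((minpoly K l).map (algebraMap K E)).Splits)
    (h : AdmitsCyclicHopfGaloisStructure K L) :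
    ∃ f : (L →ₐ[K] E) ≃ ZMod n, IsAffineLabelling f := by
  subst hn
  obtain ⟨N, _, _, H, _, _, ⟨S⟩, ⟨Φ⟩⟩ := h
  have := isNormalClosure_normalClosureOver K L
  let ι : NormalClosureOver K L →ₐ[K] E := IsNormalClosure.lift hsplits
  let := ι.toRingHom.toAlgebra
  have : IsScalarTower K (NormalClosureOver K L) E :=
    .of_algebraMap_eq fun x => (ι.commutes x).symm
  exact S.exists_equiv_zmod Φ (by
    rw [← AlgHom.card_of_splits K L E hsplits, Nat.card_eq_fintype_card])

/-- The units of `ZMod n` acting by multiplication on the additive group. -/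
def zmodUnitsMulAut (n : ℕ) : (ZMod n)ˣ →* MulAut (Multiplicative (ZMod n)) where
  toFun u :=
    { toFun := fun ν => .ofAdd (u * ν.toAdd)
      invFun := fun ν => .ofAdd (↑u⁻¹ * ν.toAdd)
      left_inv := fun ν => by simp
      right_inv := fun ν => by simp
      map_mul' := fun ν μ => by simp [mul_add] }
  map_one' := by ext; simp
  map_mul' u v := by ext; simp [mul_assoc]

/-- Translation of the labels. -/
def translateLabel {X : Type*} {n : ℕ} (f : X ≃ ZMod n) :
    Multiplicative (ZMod n) →* Equiv.Perm X :=
  MonoidHom.toHomPerm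
    { toFun := fun ν x => f.symm (f x + ν.toAdd)
      map_one' := by funext x; simp; rfl
      map_mul' := fun ν μ => by
        funext x
        change f.symm _ = f.symm (f (f.symm _) + _)
        rw [f.apply_symm_apply, toAdd_mul, add_comm ν.toAdd, add_assoc] }

theorem apply_translateLabel {X : Type*} {n : ℕ} (f : X ≃ ZMod n) (ν : Multiplicative (ZMod n))
    (x : X) : f (translateLabel f ν x) = f x + ν.toAdd :=
  f.apply_symm_apply _

theorem IsAffineLabelling.of_algHom {M : Type*} [Field M] [Algebra K M] [Normal K M] [Normal K E]
    {n : ℕ} (hn : Module.finrank K L = n)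
    (hsplits : ∀ l : L, ((minpoly K l).map (algebraMap K M)).Splits) (j : M →ₐ[K] E)
    {f : (L →ₐ[K] E) ≃ ZMod n} (hf : IsAffineLabelling f) :
    ∃ f : (L →ₐ[K] M) ≃ ZMod n, IsAffineLabelling f := by
  have : NeZero n := ⟨hn ▸ Module.finrank_pos.ne'⟩
  have hinj : Function.Injective fun x : L →ₐ[K] M => j.comp x := fun x y h =>
    AlgHom.ext fun l => j.injective (DFunLike.congr_fun h l)
  have hbij : Function.Bijective fun x : L →ₐ[K] M => f (j.comp x) := by
    refine (Nat.bijective_iff_injective_and_card _).2 ⟨f.injective.comp hinj, ?_⟩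
    rw [Nat.card_eq_fintype_card, AlgHom.card_of_splits K L M hsplits, Nat.card_zmod, hn]
  refine ⟨.ofBijective _ hbij, fun σ => ?_⟩
  let := j.toRingHom.toAlgebra
  have : IsScalarTower K M E := .of_algebraMap_eq fun x => (j.commutes x).symm
  obtain ⟨a, b, h⟩ := hf (σ.liftNormal E)
  refine ⟨a, b, fun x => ?_⟩
  change f (j.comp ((σ : M →ₐ[K] M).comp x)) = a * f (j.comp x) + b
  rw [← h]
  refine congrArg f (AlgHom.ext fun l => ?_)
  exact (σ.liftNormal_commutes E (x l)).symm

/-- `N = ZMod n` acts by translating labels, and Galois acts on `N` through the linear parts `a`.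
The required compatibility is `a * (y + ν) + b = (a * y + b) + a * ν`. -/
theorem IsAffineLabelling.admitsCyclicHopfGaloisStructure [Normal K E] {n : ℕ}
    (hn : Module.finrank K L = n)
    (hsplits : ∀ l : L, ((minpoly K l).map (algebraMap K E)).Splits)
    {f : (L →ₐ[K] E) ≃ ZMod n} (hf : IsAffineLabelling f) :
    AdmitsCyclicHopfGaloisStructure K L := by
  have : NeZero n := ⟨hn ▸ Module.finrank_pos.ne'⟩
  -- Taken inside an algebraic closure of `K`, so that the Hopf algebra lives in the universe of
  -- `K`.
  let M := IntermediateField.normalClosure K L (AlgebraicClosure K)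
  have hM : IsNormalClosure K L M :=
    Algebra.IsAlgebraic.isNormalClosure_normalClosure fun _ => IsAlgClosed.splits _
  have hMfin : FiniteDimensional K M := IsNormalClosure.finiteDimensional K L M
  have hMgal : IsGalois K M := IsNormalClosure.isGalois K L M
  obtain ⟨f, hf⟩ := hf.of_algHom hn hM.splits (hM.lift hsplits)
  have hL := isNormalClosure_normalClosureOver K L
  let j : M →ₐ[K] NormalClosureOver K L := hM.lift hL.splits
  let := j.toRingHom.toAlgebra
  have : IsScalarTower K M (NormalClosureOver K L) :=
    .of_algebraMap_eq fun x => (j.commutes x).symm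
  let χ : (M ≃ₐ[K] M) →* MulAut (Multiplicative (ZMod n)) :=
    (zmodUnitsMulAut n).comp hf.toAffineAction.a.toHomUnits
  have hχ : ∀ σ ν, (χ σ ν).toAdd = hf.toAffineAction.a σ * ν.toAdd := fun σ ν => rfl
  have : Nonempty (L →ₐ[K] M) := ⟨f.symm 0⟩
  refine ⟨Multiplicative (ZMod n), inferInstance, inferInstance,
    twistedGroupAlgebra K χ, inferInstance, inferInstance,
    TwistedGroupAlgebra.exists_hopfGaloisStructure χ (translateLabel f) (fun σ ν x => ?_)
      AlgHom.exists_algEquiv_comp_eq (fun x ν μ h => ?_) ?_,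
    ⟨TwistedGroupAlgebra.baseChangeBialgEquiv χ _⟩⟩
  · apply f.injective
    rw [hf.apply_comp, apply_translateLabel, apply_translateLabel, hf.apply_comp, hχ]
    ring
  · have := congrArg f h
    rw [apply_translateLabel, apply_translateLabel] at this
    exact Multiplicative.toAdd.injective (add_left_cancel this)
  · rw [hn]
    exact Nat.card_zmod n

end Criterion

theorem theorem1p2 {K : Type u} {L : Type v} {E : Type w} [Field K] [Field L] [Field E]
    [Algebra K L] [Algebra K E] [FiniteDimensional K L] [Algebra.IsSeparable K L]
    [IsNormalClosure K L E] (e : ℕ) (hdeg : Module.finrank K L = 2 ^ e)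
    (hL : AdmitsCyclicHopfGaloisStructure K L) :
    ∃ s : ℕ, Nat.card Gal(E/K) = 2 ^ s * Module.finrank K L ∧
      (s = 1 → (∃ g : Gal(E/K), orderOf g = Module.finrank K L) →
        ∀ L' : IntermediateField K E, IsParallelTo L' L → AdmitsCyclicHopfGaloisStructure K L') ∧
      ((s = 1 ∧ ¬ ∃ g : Gal(E/K), orderOf g = Module.finrank K L) ∨ 2 ≤ s →
        ∃ L' : IntermediateField K E, IsParallelTo L' L ∧ Normal K L' ∧
          ¬ AdmitsCyclicHopfGaloisStructure K L') := by
  have hfin : FiniteDimensional K E := IsNormalClosure.finiteDimensional K L E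
  have hgal : IsGalois K E := IsNormalClosure.isGalois K L E
  have hsplits (L' : IntermediateField K E) (l : L') :
      ((minpoly K l).map (algebraMap K E)).Splits := by
    rw [← minpoly.algHom_eq L'.val L'.val.injective]
    exact hgal.to_normal.splits _
  obtain ⟨f, hf⟩ := hL.exists_isAffineLabelling hdeg (IsNormalClosure.splits (L := E))
  obtain ⟨A, hA, hT⟩ : ∃ A : AffineAction Gal(E/K) (2 ^ e), A.Faithful ∧ A.Transitive :=
    ⟨hf.toAffineAction, hf.toAffineAction_faithful, hf.toAffineAction_transitive⟩
  obtain ⟨s, hs⟩ := A.exists_card_eq hA hT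
  refine ⟨s, hdeg ▸ hs, ?_, ?_⟩
  · rintro rfl ⟨g, hg⟩ L' hL'
    have hL'2 : Module.finrank K L' = 2 ^ e := Eq.trans hL' hdeg
    have hJ : Nat.card L'.fixingSubgroup = 2 := by
      have := L'.fixingSubgroup.card_mul_index
      rw [← L'.finrank_eq_fixingSubgroup_index, hL'2, hs, pow_one] at this
      exact Nat.eq_of_mul_eq_mul_right (by positivity) this
    obtain ⟨A', hT', hA'⟩ := A.exists_stabilizer_eq hA hT (by rw [hs, pow_one]) (hg.trans hdeg) hJ
    obtain ⟨f', hf'⟩ := A'.exists_isAffineLabelling hT' L' hA'.symm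
    exact hf'.admitsCyclicHopfGaloisStructure hL'2 (hsplits L')
  · intro hcase
    rw [hdeg] at hcase
    -- For `e = 0` a faithful action on one point makes `G` trivial, so `s = 0`, which is excluded
    -- in this case.
    have he : 1 ≤ e := by
      by_contra! h0
      obtain rfl : e = 0 := by lia
      have hsub : Subsingleton Gal(E/K) := ⟨fun g h => by
        have key : ∀ g : Gal(E/K), g = 1 := fun g =>
          hA g (Subsingleton.elim (α := ZMod 1) _ _) (Subsingleton.elim (α := ZMod 1) _ _)
        rw [key g, key h]⟩
      rw [Nat.card_eq_one_iff_unique.2 ⟨hsub, ⟨1⟩⟩, pow_zero, mul_one] at hs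
      have := (Nat.pow_eq_one.1 hs.symm).resolve_left (by norm_num)
      lia
    have hse := (A.two_pow_succ_dvd_card_ker hA he hs).2
    have he2 : 2 ≤ e := by lia
    let J := A.torsionTranslations s
    let L' := IntermediateField.fixedField J
    have hJ : L'.fixingSubgroup = J := IntermediateField.fixingSubgroup_fixedField J
    have hL' : Module.finrank K L' = 2 ^ e := by
      have := J.card_mul_index
      rw [A.card_torsionTranslations hA he hs, hs] at this
      rw [L'.finrank_eq_fixingSubgroup_index, hJ]
      exact Nat.eq_of_mul_eq_mul_left (by positivity) this
    have hgal' : IsGalois K L' := IsGalois.of_fixedField_normal_subgroup J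
    refine ⟨L', hL'.trans hdeg.symm, hgal'.to_normal, fun hadm => ?_⟩
    obtain ⟨f', hf'⟩ := hadm.exists_isAffineLabelling hL' (hsplits L')
    -- A cyclic structure on `L'` would give some `g` whose power `g ^ 2 ^ (e - 2)` moves the
    -- embedding labelled `0`. But that power lies in `J`, and by normality every embedding of `L'`
    -- has image `L'`, which `J` fixes.
    obtain ⟨g, hg⟩ := hf'.toAffineAction.exists_b_pow_ne_zero hf'.toAffineAction_transitive he2
    apply hg
    have hmem := A.pow_mem_torsionTranslations hA he2 hcase hs g
    have hfix : ((g ^ 2 ^ (e - 2) : Gal(E/K)) : E →ₐ[K] E).comp (f'.symm 0) = f'.symm 0 := by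
      refine AlgHom.ext fun l => ?_
      have hl : f'.symm 0 l ∈ L' :=
        (AlgHom.fieldRange_of_normal (f'.symm 0)).le ⟨l, rfl⟩
      exact (IntermediateField.mem_fixingSubgroup_iff _ _).1 (hJ.symm ▸ hmem) _ hl
    rw [hf'.toAffineAction_b, hfix, f'.apply_symm_apply]
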